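/- **Setting.** A zero-one covering program is $\min w^{T}x$ subject to $Ax\ge b$, $x\in\{0,1\}^n$, where $A\in\mathbb R_{\ge 0}^{m\times n}$, $b\in\mathbb R_{\ge0}^m$, $w\in\mathbb R_{\ge0}^n$. Let $f(A)$ and $\Delta(A)$ be the maximum number of nonzero entries in a row and in a column of $A$. The communication network is the bipartite graph on variable nodes $x_1,\dots,x_n$ and constraint nodes $c_1,\dots,c_m$ with a link $\{x_j,c_i\}$ whenever $A_{i,j}\ne0$. Node $x_j$ is given $w_j$ and the $j$-th column of $A$; node $c_i$ is given $b_i$; all nodes know their identifiers, $n,m,f(A),\Delta(A)$ and $\varepsilon$, and a fixed number format in which each input number is represented by $O(\log(n+m))$ bits. Computation is deterministic and proceeds in synchronous rounds; in each round each node may send to each neighbour a message of $O(\log(n+m))$ bits (CONGEST); local computation is free. The running time is the number of rounds after which all nodes have halted; each $x_j$ then outputs its value. **The function $T$.** For a hypergraph $G=(V,E)$ (a finite set of nonempty hyperedges) with positive vertex weights $w(v)$, let $E(v)$ be the set of hyperedges containing $v$. For a real constant $\gamma>0$, natural numbers $f,D$ and $\varepsilon\in(0,1]$ put $\beta=\varepsilon/(f+\varepsilon)$,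 $q=\frac{\log D}{f\log(f/\varepsilon)\log\log D}$, and $\alpha=\max(2,q)$ if $q\ge(\log D)^{\gamma/2}$, $\alpha=2$ otherwise (for small $f,D$ with $q$ undefined, $\alpha=2$). Algorithm MWHVC, in the version in which a vertex levels up at most once per iteration, is the following. Iteration $0$: $C=\emptyset$, $\ell(v)=0$, $\mathrm{deal}(e)=\delta(e)=\frac12\min_{v\in e}w(v)/|E(v)|$. Iteration $i\ge1$: (a) every $v$ contained in an uncovered hyperedge with $\sum_{e\in E(v)}\delta(e)\ge(1-\beta)w(v)$ joins $C$; (b) let $E'(v)$ be the set of hyperedges of $E(v)$ still disjoint from $C$; every $v$ with $E'(v)\neq\emptyset$, while $\sum_{e\in E(v)}\delta(e)>w(v)(1-2^{-\ell(v)-1})$, increments $\ell(v)$ and halves $\mathrm{deal}(e)$ for all $e\in E'(v)$; (c) then every such $v$ sends "raise" to all $e\in E'(v)$ if $\sum_{e\in E'(v)}\mathrm{deal}(e)\le\frac1\alpha2^{-\ell(v)-1}w(v)$, and "stuck" otherwise; (d) every uncovered $e$ that received only "raise" multiplies $\mathrm{deal}(e)$ by $\alpha$, and for every uncovered $e$,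 $\delta(e)$ increases by $\mathrm{deal}(e)/2$. It terminates in the first iteration in which all hyperedges are covered by $C$; iteration $0$ costs two rounds and each later iteration four. Let $T_\gamma(f,D,\varepsilon)$ be the maximum number of rounds of this algorithm over all hypergraphs of rank at most $f$ and maximum degree at most $D$ and all positive vertex weights. **Claim.** For every constant $\gamma>0$ there is a deterministic distributed CONGEST algorithm that, for every $\varepsilon\in(0,1]$ and every feasible zero-one covering program, computes $x\in\{0,1\}^n$ with $Ax\ge b$ and $w^Tx\le(f(A)+\varepsilon)\cdot w^Ty$ for all $y\in\{0,1\}^n$ with $Ay\ge b$, and whose number of rounds is $$O\!\left(\Bigl(1+\frac{f(A)}{\log n}\Bigr)\cdot T_\gamma\bigl(f(A),2^{f(A)}\Delta(A),\varepsilon\bigr)\right)$$ (for $n\le 1$ the factor $1+f(A)/\log n$ is read as $1$). Moreover, with $f=f(A)$ and $D=2^{f(A)}\Delta(A)$, if $D\ge3$, the same number of rounds is $$O\!\left(\Bigl(1+\frac{f}{\log n}\Bigr)\Bigl(f\log\frac f\varepsilon+\frac{\log D}{\log\log D}+\min\bigl\{\log D,\;f\log\tfrac f\varepsilon\cdot(\log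 D)^{\gamma}\bigr\}\Bigr)\right).$$ The implied constants depend only on $\gamma$ and on the constant in the bound on the input length. -/

import Mathlib

open scoped ENNReal

noncomputable section

namespace DistCover

/-! ## Algorithm MWHVC (minimum weight hypergraph vertex cover) -/

/-- A hypergraph on the vertex set `V`: a finite set of nonempty hyperedges. -/
structure Hypergraph (V : Type) where
  edges : Finset (Finset V)
  nonempty_of_mem : ∀ e ∈ edges, e.Nonempty

section MWHVC

variable {V : Type} [Fintype V] [DecidableEq V]

/-- `E(v)`, the set of hyperedges that contain `v`. -/
def Hypergraph.incident (H : Hypergraph V) (v : V) : Finset (Finset V) :=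
  H.edges.filter fun e => v ∈ e

/-- Every hyperedge has at most `f` vertices. -/
def Hypergraph.RankLE (H : Hypergraph V) (f : ℕ) : Prop :=
  ∀ e ∈ H.edges, e.card ≤ f

/-- Every vertex belongs to at most `D` hyperedges. -/
def Hypergraph.DegreeLE (H : Hypergraph V) (D : ℕ) : Prop :=
  ∀ v, (H.incident v).card ≤ D

/-- The variables of Algorithm MWHVC at the end of an iteration: the cover `C`, the levels `ℓ(v)`,
the deals and the dual variables `δ(e)`. -/
structure MState (V : Type) where
  cover : Finset V
  level : V → ℕ
  deal : Finset V → ℝ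
  dual : Finset V → ℝ

/-- The hyperedges that are not covered by `C`. -/
def Hypergraph.uncovered (H : Hypergraph V) (C : Finset V) : Finset (Finset V) :=
  H.edges.filter fun e => Disjoint e C

/-- `E'(v)`, the hyperedges that contain `v` and are not covered by `C`. -/
def Hypergraph.uncoveredAt (H : Hypergraph V) (C : Finset V) (v : V) : Finset (Finset V) :=
  (H.uncovered C).filter fun e => v ∈ e

/-- Iteration `0`: `C = ∅`, all levels are `0`, and
`deal(e) = δ(e) = 0.5 * min_{v ∈ e} w(v) / |E(v)|`. -/
def MState.init (H : Hypergraph V) (w : V → ℝ) : MState V :=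
  let d : Finset V → ℝ := fun e =>
    if h : e.Nonempty then (1 / 2) * e.inf' h (fun v => w v / ((H.incident v).card : ℝ)) else 0
  { cover := ∅, level := fun _ => 0, deal := d, dual := d }

/-- The load `∑_{e ∈ E(v)} δ(e)` of a vertex. -/
def MState.load (H : Hypergraph V) (S : MState V) (v : V) : ℝ :=
  ∑ e ∈ H.incident v, S.dual e

/-- The cover after the tightness check: every active vertex with `∑ δ(e) ≥ (1 - β) w(v)`
joins. -/
def MState.newCover (H : Hypergraph V) (w : V → ℝ) (β : ℝ) (S : MState V) : Finset V :=
  open Classical in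
  S.cover ∪ Finset.univ.filter fun v =>
    (H.uncoveredAt S.cover v).Nonempty ∧ (1 - β) * w v ≤ S.load H v

/-- The level of `v` after the loop
`while ∑ δ(e) > w(v) (1 - 0.5 ^ (ℓ(v) + 1)) do ℓ(v) := ℓ(v) + 1`,
which is executed by the active vertices, those in some hyperedge not covered by `C`. -/
def MState.newLevel (H : Hypergraph V) (w : V → ℝ) (S : MState V) (C : Finset V) (v : V) : ℕ :=
  open Classical in
  if (H.uncoveredAt C v).Nonempty then
    sInf {k : ℕ | S.level v ≤ k ∧ S.load H v ≤ w v * (1 - (1 / 2) ^ (k + 1))}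
  else S.level v

/-- One iteration `i ≥ 1` of Algorithm MWHVC, with tightness parameter `β`, multiplier `α`, and
with every dual variable of an uncovered hyperedge being increased by `s * deal(e)`.
The plain algorithm is `s = 1`; the version in which the level of a vertex increases at most once
per iteration is `s = 1 / 2`. -/
def MState.step (H : Hypergraph V) (w : V → ℝ) (β α s : ℝ) (S : MState V) : MState V :=
  open Classical in
  let C := S.newCover H w β
  let lev : V → ℕ := S.newLevel H w C
  -- every level increment of a vertex of `e` halves the deal of `e`
  let scaled : Finset V → ℝ := fun e => S.deal e * (1 / 2) ^ (∑ v ∈ e, (lev v - S.level v))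
  -- `v` sends `raise` (and otherwise `stuck`)
  let raise : V → Prop := fun v =>
    ∑ e ∈ H.uncoveredAt C v, scaled e ≤ (1 / α) * (1 / 2) ^ (lev v + 1) * w v
  let newDeal : Finset V → ℝ := fun e =>
    if e ∈ H.uncovered C then (if ∀ v ∈ e, raise v then α * scaled e else scaled e) else S.deal e
  { cover := C
    level := lev
    deal := newDeal
    dual := fun e => if e ∈ H.uncovered C then S.dual e + s * newDeal e else S.dual e }

/-- The state at the end of iteration `i`. -/
def MState.after (H : Hypergraph V) (w : V → ℝ) (β α s : ℝ) (i : ℕ) : MState V :=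
  (MState.step H w β α s)^[i] (MState.init H w)

/-- The number of communication rounds until termination, which happens in the first iteration
`i` at whose end all hyperedges are covered: two rounds for iteration `0` and four rounds for each
iteration `i ≥ 1` (vertices announce that they join the cover; hyperedges announce that they are
covered; vertices send level increments and `raise` / `stuck`; hyperedges send the deals). It is
`⊤` if the algorithm does not terminate. -/
def mwhvcRoundsOn (H : Hypergraph V) (w : V → ℝ) (β α s : ℝ) : ℕ∞ :=
  ⨅ (i : ℕ) (_ : H.uncovered (MState.after H w β α s i).cover = ∅), ((2 + 4 * i : ℕ) : ℕ∞)

end MWHVC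

/-- The multiplier `α`, as a function of the rank `f`, the maximum degree `D`, the approximation
parameter `ε` and the constant `γ`. -/
def multiplier (γ : ℝ) (f D : ℕ) (ε : ℝ) : ℝ :=
  let q : ℝ := Real.log D / (f * Real.log (f / ε) * Real.log (Real.log D))
  if Real.log D ^ (γ / 2) ≤ q then max 2 q else 2

/-- `T(f, D, ε)`: the worst-case round complexity of Algorithm MWHVC, in the version in which the
level of a vertex increases at most once per iteration, over all hypergraphs of rank at most `f`
and maximum degree at most `D` with positive vertex weights. Here `β = ε / (f + ε)`. -/
def mwhvcRounds (γ : ℝ) (f D : ℕ) (ε : ℝ) : ℕ∞ :=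
  ⨆ (k : ℕ) (H : Hypergraph (Fin k)) (w : Fin k → ℝ)
    (_ : H.RankLE f ∧ H.DegreeLE D ∧ ∀ v, 0 < w v),
    mwhvcRoundsOn H w (ε / (f + ε)) (multiplier γ f D ε) (1 / 2)

/-- The closed expression
`f log(f/ε) + log D / log log D + min {log D, f log(f/ε) (log D)^γ}`. -/
def closedBound (γ : ℝ) (f D : ℕ) (ε : ℝ) : ℝ :=
  f * Real.log (f / ε) + Real.log D / Real.log (Real.log D)
    + min (Real.log D) (f * Real.log (f / ε) * Real.log D ^ γ)

/-! ## Synchronous message passing with bounded messages -/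

/-- A deterministic distributed algorithm for nodes with identifiers in `N`, local inputs in `I`
and outputs in `O`. Messages are bit strings; local computation is not restricted. -/
structure DistAlgorithm (N I O : Type) where
  State : Type
  init : N → I → State
  /-- the message a node in a given state sends to a given neighbour -/
  send : State → N → List Bool
  /-- the new state, given the messages received, indexed by the sender -/
  receive : State → (N → List Bool) → State
  halted : State → Bool
  output : State → O

/-- The states of all nodes after `t` synchronous rounds on the network `G` with local inputs
`inp`. Messages travel along links of `G` only; a halted node is silent and keeps its state. -/
def DistAlgorithm.config {N I O : Type} (alg : DistAlgorithm N I O) (G : SimpleGraph N)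
    (inp : N → I) : ℕ → N → alg.State
  | 0 => fun v => alg.init v (inp v)
  | t + 1 => fun v =>
    open Classical in
    let S := alg.config G inp t
    if alg.halted (S v) then S v
    else alg.receive (S v) fun u =>
      if G.Adj u v ∧ alg.halted (S u) = false then alg.send (S u) v else []

/-- All messages that are sent in the execution have at most `bits` bits. -/
def DistAlgorithm.MessagesLE {N I O : Type} (alg : DistAlgorithm N I O) (G : SimpleGraph N)
    (inp : N → I) (bits : ℕ) : Prop :=
  ∀ (t : ℕ) (u v : N), G.Adj u v → alg.halted (alg.config G inp t u) = false →
    (alg.send (alg.config G inp t u) v).length ≤ bits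

/-- All nodes have halted after `R` rounds. -/
def DistAlgorithm.HaltsWithin {N I O : Type} (alg : DistAlgorithm N I O) (G : SimpleGraph N)
    (inp : N → I) (R : ℕ) : Prop :=
  ∀ v, alg.halted (alg.config G inp R v) = true

/-- `⌊log₂ N⌋ + 1`, the number of bits of a positive number `N`. -/
def bitSize (N : ℕ) : ℕ := Nat.log 2 N + 1

/-! ## Zero-one covering programs and their communication network -/

section Programs

variable {m n : ℕ}

/-- `f(A)`: the maximum number of nonzero entries in a row. -/
def rowSupport (A : Matrix (Fin m) (Fin n) ℝ) : ℕ :=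
  Finset.univ.sup fun i => (Finset.univ.filter fun j => A i j ≠ 0).card

/-- `Δ(A)`: the maximum number of nonzero entries in a column. -/
def colSupport (A : Matrix (Fin m) (Fin n) ℝ) : ℕ :=
  Finset.univ.sup fun j => (Finset.univ.filter fun i => A i j ≠ 0).card

/-- The program `min wᵀ x` subject to `A x ≥ b`, `x ∈ {0,1}ⁿ` is a covering program. -/
def IsCovering (A : Matrix (Fin m) (Fin n) ℝ) (b : Fin m → ℝ) (w : Fin n → ℝ) : Prop :=
  (∀ i j, 0 ≤ A i j) ∧ (∀ i, 0 ≤ b i) ∧ ∀ j, 0 ≤ w j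

/-- `x` is a zero-one vector with `A x ≥ b`. -/
def IsZeroOneSolution (A : Matrix (Fin m) (Fin n) ℝ) (b : Fin m → ℝ) (x : Fin n → ℝ) : Prop :=
  (∀ j, x j = 0 ∨ x j = 1) ∧ ∀ i, b i ≤ A.mulVec x i

/-- `x` is a zero-one solution whose weight is at most `ρ` times that of every zero-one
solution. -/
def IsApproxSolution (A : Matrix (Fin m) (Fin n) ℝ) (b : Fin m → ℝ) (w : Fin n → ℝ) (ρ : ℝ)
    (x : Fin n → ℝ) : Prop :=
  IsZeroOneSolution A b x ∧ ∀ y, IsZeroOneSolution A b y → w ⬝ᵥ x ≤ ρ * (w ⬝ᵥ y)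

/-- The bipartite communication network: variable nodes `Sum.inl j`, constraint nodes `Sum.inr i`,
and a link between `x_j` and `c_i` iff `A i j ≠ 0`. -/
def network (A : Matrix (Fin m) (Fin n) ℝ) : SimpleGraph (Fin n ⊕ Fin m) :=
  SimpleGraph.fromRel fun u v => ∃ j i, u = Sum.inl j ∧ v = Sum.inr i ∧ A i j ≠ 0

/-- Local inputs: a variable node has its weight and its column of `A`, a constraint node has its
right-hand side. -/
inductive LocalInput (m : ℕ) : Type
  | ofVariable (weight : ℝ) (column : Fin m → ℝ) : LocalInput m
  | ofConstraint (rhs : ℝ) : LocalInput m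

/-- The distribution of the input among the nodes. -/
def localInput (A : Matrix (Fin m) (Fin n) ℝ) (b : Fin m → ℝ) (w : Fin n → ℝ) :
    Fin n ⊕ Fin m → LocalInput m
  | Sum.inl j => LocalInput.ofVariable (w j) (fun i => A i j)
  | Sum.inr i => LocalInput.ofConstraint (b i)

/-- In the number format `dec`, the number `r` is represented by a string of at most `bits`
bits. -/
def HasCode (dec : List Bool → ℝ) (bits : ℕ) (r : ℝ) : Prop :=
  ∃ s : List Bool, s.length ≤ bits ∧ dec s = r

/-- All numbers of the input are represented by at most `bits` bits each. -/
def InputHasCodes (dec : List Bool → ℝ) (bits : ℕ) (A : Matrix (Fin m) (Fin n) ℝ)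
    (b : Fin m → ℝ) (w : Fin n → ℝ) : Prop :=
  (∀ i j, HasCode dec bits (A i j)) ∧ (∀ i, HasCode dec bits (b i)) ∧ ∀ j, HasCode dec bits (w j)

end Programs

end DistCover

end

/-!
A zero-one vector violates a constraint as soon as it vanishes on a set of its variables without
which the left-hand side is too small. Taking these sets, restricted to variables of nonzero weight,
as hyperedges turns the program into minimum weight vertex cover on a hypergraph of rank at most
`f(A)` and degree at most `2 ^ f(A) Δ(A)`, for which Algorithm MWHVC is an `(f + ε)`-approximation:
its duals form a fractional packing, and the vertices of the cover are almost tight.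

The hyperedges of one constraint may be exponentially many, so they are never communicated: the
variables only announce their degree, which has about `f + log m` bits, and then in each iteration
three bits (joining the cover, level increment, `raise`), which every constraint passes on to its
variables. From these the variables of a hyperedge determine its deal and dual by themselves. An
announcement within a constraint concatenates up to `f` reports and so takes `O(1 + f / log n)`
rounds if each report has `O(log n)` bits. The first reports may be longer by `f` bits and cost
`O(f (1 + f / log n))` rounds, but `T` is of order at least `f` because MWHVC is slow on stars of
large degree with suitable weights. For `f ≤ 1` no communication beyond a constant number of
rounds is needed: one selects all variables of the constraints with a positive right-hand side.

That a node acts on its local knowledge is made precise by information instead of code: it remembers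
the set of all instances compatible with its input and with the messages received, and sends what
is sent in an arbitrary one of them; this is sound once messages are shown to depend on the
knowledge only.

For the closed form of the round bound, let the base deal of a hyperedge be its deal with the level
increments undone. In an iteration in which the hyperedge `e` remains uncovered, either its base
deal is multiplied by `α`, or some vertex of `e` is stuck and its slack, the weight minus the load,
drops by a factor of about `1 - 1 / (4 α)`. Hence `log_α` of the base deal minus `4 α` times the sum
of the logarithms of the slacks of the vertices of `e` increases by at least `1`. It ranges over an
interval of length `O(log D / log α + α f log (f / ε))`, since deals are bounded by weights and a
slack below `β w(v)` puts `v` into the cover.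
-/

namespace DistCover

noncomputable section

/-! ## Algorithms from transcripts -/

/-- All nodes halt within `R` rounds, with outputs `out`, having sent messages of at most `bits`
bits. -/
structure DistAlgorithm.Computes {N I O : Type} (alg : DistAlgorithm N I O) (G : SimpleGraph N)
    (inp : N → I) (bits R : ℕ) (out : N → O) : Prop where
  messagesLE : alg.MessagesLE G inp bits
  haltsWithin : alg.HaltsWithin G inp R
  output_eq : ∀ v, alg.output (alg.config G inp R v) = out v

theorem DistAlgorithm.config_succ_of_halted {N I O : Type} {alg : DistAlgorithm N I O}
    {G : SimpleGraph N} {inp : N → I} {t : ℕ} {v : N}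
    (h : alg.halted (alg.config G inp t v) = true) :
    alg.config G inp (t + 1) v = alg.config G inp t v :=
  if_pos h

open Classical in
theorem DistAlgorithm.config_succ_of_running {N I O : Type} {alg : DistAlgorithm N I O}
    {G : SimpleGraph N} {inp : N → I} {t : ℕ}
    (h : ∀ v, alg.halted (alg.config G inp t v) = false) (v : N) :
    alg.config G inp (t + 1) v = alg.receive (alg.config G inp t v) fun u =>
      if G.Adj u v then alg.send (alg.config G inp t u) v else [] := by
  refine (if_neg (by simp [h])).trans (congrArg _ (funext fun u => ?_))
  exact if_congr (and_iff_left (h u)) rfl rfl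

/-- A family of instances `P : Ω` of a distributed problem, with the messages `message P t u v` that
the node `u` is to send to the node `v` in round `t` on the instance `P`. -/
structure Transcript (Ω N I : Type) where
  network : Ω → SimpleGraph N
  input : Ω → N → I
  message : Ω → ℕ → N → N → List Bool
  message_eq_nil : ∀ P t {u v}, ¬ (network P).Adj u v → message P t u v = []

namespace Transcript

variable {Ω N I O : Type} (M : Transcript Ω N I)

/-- After `t` rounds the node `v` has seen nothing that distinguishes the instances `P` and `P'`. -/
structure SameView (P P' : Ω) (t : ℕ) (v : N) : Prop where
  input_eq : M.input P v = M.input P' v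
  message_eq : ∀ s < t, ∀ u, M.message P s u v = M.message P' s u v

/-- In the first `R` rounds, what a node sends depends only on what it has seen. -/
def IsLocal (R : ℕ) : Prop :=
  ∀ ⦃P P' t v⦄, t < R → M.SameView P P' t v → M.message P t v = M.message P' t v

/-- The outputs `out` of the nodes depend only on what they have seen after `R` rounds. -/
def Determines (R : ℕ) (out : Ω → N → O) : Prop :=
  ∀ ⦃P P' v⦄, M.SameView P P' R v → out P v = out P' v

/-- The state of a node that remembers which instances are possible in view of its input and of
the messages it has received. -/
structure Knowledge (Ω N : Type) where
  time : ℕ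
  node : N
  possible : Set Ω

open Classical in
/-- The algorithm in which every node acts as in an arbitrary instance that it considers possible,
and halts after `R` rounds. -/
def algorithm [Inhabited O] (R : ℕ) (out : Ω → N → O) : DistAlgorithm N I O where
  State := Knowledge Ω N
  init v x := ⟨0, v, {P | x = M.input P v}⟩
  send S u := if h : S.possible.Nonempty then M.message h.some S.time S.node u else []
  receive S msg :=
    ⟨S.time + 1, S.node, {P ∈ S.possible | ∀ u, msg u = M.message P S.time u S.node}⟩
  halted S := decide (R ≤ S.time)
  output S := if h : S.possible.Nonempty then out h.some S.node else default

/-- What the node `v` knows after `t` rounds on the instance `P`. -/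
def knowledge [Inhabited O] (R : ℕ) (out : Ω → N → O) (P : Ω) (t : ℕ) (v : N) :
    (M.algorithm R out).State :=
  Knowledge.mk t v {P' | M.SameView P P' t v}

variable {M}

theorem SameView.refl (P : Ω) (t : ℕ) (v : N) : M.SameView P P t v :=
  ⟨rfl, fun _ _ _ => rfl⟩

theorem sameView_succ {P P' : Ω} {t : ℕ} {v : N} :
    M.SameView P P' (t + 1) v ↔
      M.SameView P P' t v ∧ ∀ u, M.message P t u v = M.message P' t u v :=
  ⟨fun h => ⟨⟨h.1, fun s hs => h.2 s (by lia)⟩, h.2 t t.lt_succ_self⟩,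
    fun h => ⟨h.1.1, Nat.forall_lt_succ_right.2 ⟨h.1.2, h.2⟩⟩⟩

variable [Inhabited O] {R : ℕ} {out : Ω → N → O}

theorem algorithm_init (P : Ω) (v : N) :
    (M.algorithm R out).init v (M.input P v) = M.knowledge R out P 0 v :=
  congrArg (Knowledge.mk 0 v) (Set.ext fun _ =>
    ⟨fun h => ⟨h, fun _ hs => absurd hs (Nat.not_lt_zero _)⟩, SameView.input_eq⟩)

theorem algorithm_receive (P : Ω) (t : ℕ) (v : N) :
    (M.algorithm R out).receive (M.knowledge R out P t v) (fun u => M.message P t u v)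
      = M.knowledge R out P (t + 1) v :=
  congrArg (Knowledge.mk (t + 1) v) (Set.ext fun _ => sameView_succ.symm)

theorem algorithm_send (hM : M.IsLocal R) (P : Ω) {t : ℕ} (ht : t < R) (v : N) :
    (M.algorithm R out).send (M.knowledge R out P t v) = M.message P t v := by
  have h : {P' | M.SameView P P' t v}.Nonempty := ⟨P, .refl P t v⟩
  funext u
  exact (dif_pos h).trans (congrFun (hM ht h.some_mem).symm u)

theorem algorithm_output (hout : M.Determines R out) (P : Ω) (v : N) :
    (M.algorithm R out).output (M.knowledge R out P R v) = out P v := by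
  have h : {P' | M.SameView P P' R v}.Nonempty := ⟨P, .refl P R v⟩
  exact (dif_pos h).trans (hout h.some_mem).symm

theorem algorithm_halted (P : Ω) (t : ℕ) (v : N) :
    (M.algorithm R out).halted (M.knowledge R out P t v) = decide (R ≤ t) := rfl

theorem algorithm_config (hM : M.IsLocal R) (P : Ω) (t : ℕ) (v : N) :
    (M.algorithm R out).config (M.network P) (M.input P) t v = M.knowledge R out P (min t R) v := by
  induction t generalizing v with
  | zero => rw [Nat.zero_min]; exact algorithm_init P v
  | succ t ih =>
    have hhalted : ∀ u, (M.algorithm R out).halted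
        ((M.algorithm R out).config (M.network P) (M.input P) t u) = decide (R ≤ t) := fun u => by
      simp [ih, algorithm_halted]
    rcases Nat.lt_or_ge t R with ht | ht
    · have hrun := fun u => (hhalted u).trans (decide_eq_false ht.not_ge)
      rw [DistAlgorithm.config_succ_of_running hrun,
        min_eq_left (Nat.succ_le_of_lt ht), ← algorithm_receive]
      simp only [ih, min_eq_left ht.le, algorithm_send hM P ht]
      refine congrArg _ (funext fun u => ?_)
      split_ifs with hadj
      · rfl
      · exact (M.message_eq_nil P t hadj).symm
    · rw [DistAlgorithm.config_succ_of_halted ((hhalted v).trans (decide_eq_true ht)), ih,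
        min_eq_right ht, min_eq_right (ht.trans t.le_succ)]

theorem exists_computes {bits : ℕ} (hM : M.IsLocal R) (hout : M.Determines R out)
    (hlen : ∀ P t u v, t < R → (M.message P t u v).length ≤ bits) :
    ∃ alg : DistAlgorithm N I O,
      ∀ P, alg.Computes (M.network P) (M.input P) bits R (out P) := by
  refine ⟨M.algorithm R out, fun P => ⟨fun t u v _ hrun => ?_, fun v => ?_, fun v => ?_⟩⟩
  · rw [algorithm_config hM] at hrun ⊢
    have ht : t < R := by simpa [algorithm_halted] using hrun
    rw [min_eq_left ht.le, algorithm_send hM P ht]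
    exact hlen P t u v ht
  · simp [algorithm_config hM, algorithm_halted]
  · rw [algorithm_config hM, min_self, algorithm_output hout]

end Transcript

/-! ## Long messages -/

/-- The `k`-th block of `b` entries of a list. -/
def chunk {α : Type} (b k : ℕ) (l : List α) : List α := (l.drop (k * b)).take b

theorem eq_of_chunk_eq {α : Type} {l l' : List α} {b L : ℕ} (hl : l.length ≤ b * L)
    (hl' : l'.length ≤ b * L) (h : ∀ k < L, chunk b k l = chunk b k l') : l = l' := by
  refine List.ext_getElem? fun x => ?_
  by_cases hx : x < b * L
  · have hb : 0 < b := Nat.pos_of_mul_pos_right (by lia : 0 < b * L)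
    have hk : x / b < L := Nat.div_lt_of_lt_mul hx
    have hxk : x / b * b + x % b = x := Nat.div_add_mod' x b
    simpa [chunk, List.getElem?_take, Nat.mod_lt x hb, List.getElem?_drop, hxk]
      using congrArg (fun block => block[x % b]?) (h _ hk)
  · rw [List.getElem?_eq_none (by lia), List.getElem?_eq_none (by lia)]

/-- The first round of step `t`, when each step `s` takes `L s` rounds. -/
def startRound (L : ℕ → ℕ) (t : ℕ) : ℕ := ∑ s ∈ Finset.range t, L s

/-- The step to which the round `r` belongs, when each step `s` takes `L s` rounds. -/
def stepOf (L : ℕ → ℕ) (r : ℕ) : ℕ := Nat.findGreatest (fun t => startRound L t ≤ r) r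

section Steps

variable {L : ℕ → ℕ}

theorem startRound_succ (L : ℕ → ℕ) (t : ℕ) : startRound L (t + 1) = startRound L t + L t :=
  Finset.sum_range_succ L t

theorem startRound_strictMono (hL : ∀ t, 0 < L t) : StrictMono (startRound L) :=
  strictMono_nat_of_lt_succ fun t => by rw [startRound_succ]; exact Nat.lt_add_of_pos_right (hL t)

theorem stepOf_startRound_add (hL : ∀ t, 0 < L t) {t k : ℕ} (hk : k < L t) :
    stepOf L (startRound L t + k) = t := by
  have hmono := startRound_strictMono hL
  have hge : t ≤ startRound L t := hmono.le_apply
  refine Nat.findGreatest_eq_iff.2 ⟨by lia, fun _ => by lia, fun t' ht' _ hle => ?_⟩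
  have hnext : startRound L (t + 1) ≤ startRound L t' := hmono.monotone ht'
  rw [startRound_succ] at hnext
  lia

theorem exists_eq_startRound_add {τ r : ℕ} (hr : r < startRound L τ) :
    ∃ t < τ, ∃ k < L t, r = startRound L t + k := by
  induction τ with
  | zero => simp [startRound] at hr
  | succ τ ih =>
    by_cases h : r < startRound L τ
    · obtain ⟨t, ht, k, hk⟩ := ih h
      exact ⟨t, by lia, k, hk⟩
    · rw [startRound_succ] at hr
      exact ⟨τ, by lia, r - startRound L τ, by lia, by lia⟩

end Steps

namespace Transcript

variable {Ω N I O : Type}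

/-- The transcript in which the messages of step `t` are sent in `L t` pieces of `bits` bits. -/
def chunked (M : Transcript Ω N I) (L : ℕ → ℕ) (bits : ℕ) : Transcript Ω N I where
  network := M.network
  input := M.input
  message P r u v := chunk bits (r - startRound L (stepOf L r)) (M.message P (stepOf L r) u v)
  message_eq_nil P r u v h := by rw [M.message_eq_nil P _ h]; simp [chunk]

variable {M : Transcript Ω N I} {τ bits : ℕ} {L : ℕ → ℕ}

theorem chunked_message (hL : ∀ t, 0 < L t) (P : Ω) {t k : ℕ} (hk : k < L t) (u v : N) :
    (M.chunked L bits).message P (startRound L t + k) u v = chunk bits k (M.message P t u v) := by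
  simp only [chunked, stepOf_startRound_add hL hk, Nat.add_sub_cancel_left]

theorem SameView.of_chunked (hL : ∀ t, 0 < L t)
    (hlen : ∀ P t u v, t < τ → (M.message P t u v).length ≤ bits * L t) {P P' : Ω} {t r : ℕ}
    {v : N} (ht : t ≤ τ) (hr : startRound L t ≤ r) (h : (M.chunked L bits).SameView P P' r v) :
    M.SameView P P' t v := by
  refine ⟨h.input_eq, fun s hs u => eq_of_chunk_eq (hlen P s u v (by lia))
    (hlen P' s u v (by lia)) fun k hk => ?_⟩
  have hround : startRound L (s + 1) ≤ startRound L t := (startRound_strictMono hL).monotone hs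
  rw [startRound_succ] at hround
  rw [← chunked_message hL P hk, ← chunked_message hL P' hk]
  exact h.message_eq _ (by lia) u

theorem exists_computes_of_length_le [Inhabited O] {out : Ω → N → O} (hL : ∀ t, 0 < L t)
    (hlen : ∀ P t u v, t < τ → (M.message P t u v).length ≤ bits * L t) (hM : M.IsLocal τ)
    (hout : M.Determines τ out) :
    ∃ alg : DistAlgorithm N I O,
      ∀ P, alg.Computes (M.network P) (M.input P) bits (startRound L τ) (out P) := by
  refine exists_computes (M := M.chunked L bits) (fun P P' r v hr h => ?_)
    (fun P P' v h => hout (h.of_chunked hL hlen le_rfl le_rfl))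
    (fun P r u v _ => List.length_take_le _ _)
  obtain ⟨t, ht, k, hk, rfl⟩ := exists_eq_startRound_add hr
  funext u
  rw [chunked_message hL P hk, chunked_message hL P' hk,
    hM ht (h.of_chunked hL hlen ht.le (Nat.le_add_right _ _))]

end Transcript

/-! ## Encodings by bit strings of fixed length -/

/-- The `l` lowest bits of `x`. -/
def natBits (l x : ℕ) : List Bool := List.ofFn fun i : Fin l => x.testBit i

@[simp] theorem length_natBits (l x : ℕ) : (natBits l x).length = l := by simp [natBits]

theorem natBits_injOn (l : ℕ) : Set.InjOn (natBits l) (Set.Iio (2 ^ l)) := by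
  refine fun x hx y hy h => Nat.eq_of_testBit_eq fun i => ?_
  by_cases hi : i < l
  · exact congrFun (List.ofFn_injective h) ⟨i, hi⟩
  · have hli : 2 ^ l ≤ 2 ^ i := Nat.pow_le_pow_right two_pos (not_lt.1 hi)
    rw [Nat.testBit_lt_two_pow (hx.trans_le hli), Nat.testBit_lt_two_pow (hy.trans_le hli)]

/-- A bit string of length at most `K`, encoded with exactly `2 * K` bits: a mask that marks the
positions in use, and the bits. -/
def padBits (K : ℕ) (s : List Bool) : List Bool :=
  (List.ofFn fun i : Fin K => s[(i : ℕ)]?.isSome) ++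
    List.ofFn fun i : Fin K => s[(i : ℕ)]?.getD false

@[simp] theorem length_padBits (K : ℕ) (s : List Bool) : (padBits K s).length = 2 * K := by
  simp [padBits, two_mul]

theorem padBits_injOn (K : ℕ) : Set.InjOn (padBits K) {s | s.length ≤ K} := by
  intro s (hs : s.length ≤ K) s' (hs' : s'.length ≤ K) h
  obtain ⟨hmask, hbits⟩ := List.append_inj h (by simp)
  refine List.ext_getElem? fun i => ?_
  by_cases hi : i < K
  · have hmask_i := congrFun (List.ofFn_injective hmask) ⟨i, hi⟩
    have hbits_i := congrFun (List.ofFn_injective hbits) ⟨i, hi⟩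
    revert hmask_i hbits_i
    rcases s[i]? with _ | a <;> rcases s'[i]? with _ | a' <;> simp
  · rw [List.getElem?_eq_none (by lia), List.getElem?_eq_none (by lia)]

open Classical in
/-- An encoding with exactly `2 * K` bits of the numbers that have a code of at most `K` bits in the
number format `dec`. -/
def realBits (dec : List Bool → ℝ) (K : ℕ) (r : ℝ) : List Bool :=
  padBits K (if h : HasCode dec K r then h.choose else [])

@[simp] theorem length_realBits (dec : List Bool → ℝ) (K : ℕ) (r : ℝ) :
    (realBits dec K r).length = 2 * K := length_padBits _ _

theorem realBits_injOn (dec : List Bool → ℝ) (K : ℕ) :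
    Set.InjOn (realBits dec K) {r | HasCode dec K r} := by
  intro r (hr : HasCode dec K r) r' (hr' : HasCode dec K r') h
  rw [realBits, realBits, dif_pos hr, dif_pos hr'] at h
  rw [← hr.choose_spec.2, ← hr'.choose_spec.2,
    padBits_injOn K hr.choose_spec.1 hr'.choose_spec.1 h]

theorem length_flatten_of_forall {α : Type*} {l : ℕ} {a : List (List α)}
    (ha : ∀ x ∈ a, x.length = l) : a.flatten.length = a.length * l := by
  rw [List.length_flatten, List.map_congr_left ha, List.map_const', List.sum_replicate, smul_eq_mul]

theorem eq_of_flatten_eq {α : Type*} {l : ℕ} (hl : 0 < l) {a b : List (List α)}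
    (ha : ∀ x ∈ a, x.length = l) (hb : ∀ x ∈ b, x.length = l) (h : a.flatten = b.flatten) :
    a = b := by
  have hlen : a.length = b.length := by
    have := congrArg List.length h
    rw [length_flatten_of_forall ha, length_flatten_of_forall hb] at this
    exact Nat.eq_of_mul_eq_mul_right hl this
  refine List.eq_iff_flatten_eq.2 ⟨h, ?_⟩
  rw [List.map_congr_left ha, List.map_congr_left hb, List.map_const', List.map_const', hlen]

/-! ## Broadcasting within the constraints of a covering program -/

/-- The data `A`, `b`, `w` of a zero-one covering program. -/
structure Program (m n : ℕ) where
  matrix : Matrix (Fin m) (Fin n) ℝ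
  rhs : Fin m → ℝ
  weight : Fin n → ℝ

namespace Program

variable {m n : ℕ}

/-- The variables that occur in the `i`-th constraint. -/
def row (P : Program m n) (i : Fin m) : Finset (Fin n) :=
  Finset.univ.filter fun j => P.matrix i j ≠ 0

@[simp] theorem mem_row {P : Program m n} {i : Fin m} {j : Fin n} :
    j ∈ P.row i ↔ P.matrix i j ≠ 0 := by simp [row]

theorem card_row_le (P : Program m n) (i : Fin m) : (P.row i).card ≤ rowSupport P.matrix :=
  Finset.le_sup (f := fun i => (Finset.univ.filter fun j => P.matrix i j ≠ 0).card)
    (Finset.mem_univ i)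

/-- Two programs have the same data of the `j`-th variable, of its constraints, and of the variables
of these constraints. -/
structure SameAround (P P' : Program m n) (j : Fin n) : Prop where
  weight : P.weight j = P'.weight j
  column : ∀ i, P.matrix i j = P'.matrix i j
  rhs : ∀ i, P.matrix i j ≠ 0 → P.rhs i = P'.rhs i
  row : ∀ i, P.matrix i j ≠ 0 → ∀ k, P.matrix i k = P'.matrix i k
  row_weight : ∀ i, P.matrix i j ≠ 0 → ∀ k, P.matrix i k ≠ 0 → P.weight k = P'.weight k

/-- The values `x` and `x'` agree on the variables that share a constraint with the `j`-th one. -/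
def AgreeAround (P : Program m n) (j : Fin n) (x x' : Fin n → ℕ) : Prop :=
  ∀ i, P.matrix i j ≠ 0 → ∀ k, P.matrix i k ≠ 0 → x k = x' k

end Program

section Network

variable {m n : ℕ} {A : Matrix (Fin m) (Fin n) ℝ} {i : Fin m} {j : Fin n}

theorem network_adj_inl_inr : (network A).Adj (Sum.inl j) (Sum.inr i) ↔ A i j ≠ 0 := by
  simp [network]

theorem network_adj_inr_inl : (network A).Adj (Sum.inr i) (Sum.inl j) ↔ A i j ≠ 0 := by
  simp [network]

end Network

/-- The number format `dec` of the input and the lengths of the parts of a message: `numberBits` for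
the code of an input number, `idBits` for an identifier, and `valueBits p` for a value announced in
phase `p + 1`. -/
structure MessageFormat where
  dec : List Bool → ℝ
  numberBits : ℕ
  idBits : ℕ
  valueBits : ℕ → ℕ

namespace MessageFormat

variable {m n : ℕ} (F : MessageFormat)

/-- The data of `P` and the values `x` can be encoded in the format `F`. -/
structure Fits (P : Program m n) (x : ℕ → Fin n → ℕ) : Prop where
  hasCodes : InputHasCodes F.dec F.numberBits P.matrix P.rhs P.weight
  value_lt : ∀ p j, x p j < 2 ^ F.valueBits p

/-- What the `j`-th variable reports to the `i`-th constraint in phase `p`: its identifier,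
coefficient and weight in phase `0`, and the value `x p j` in phase `p + 1`. -/
def report (P : Program m n) (x : ℕ → Fin n → ℕ) (i : Fin m) (j : Fin n) : ℕ → List Bool
  | 0 => natBits F.idBits j ++
      (realBits F.dec F.numberBits (P.matrix i j) ++ realBits F.dec F.numberBits (P.weight j))
  | p + 1 => natBits (F.valueBits p) (x p j)

/-- The length of the reports in phase `p`. -/
def reportLength : ℕ → ℕ
  | 0 => F.idBits + 4 * F.numberBits
  | p + 1 => F.valueBits p

/-- The reports that the `i`-th constraint receives in phase `p`. -/
def reports (P : Program m n) (x : ℕ → Fin n → ℕ) (i : Fin m) (p : ℕ) : List (List Bool) :=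
  ((P.row i).sort (· ≤ ·)).map fun j => F.report P x i j p

/-- The answer of the `i`-th constraint in phase `p`: its right-hand side and all reports. -/
def answer (P : Program m n) (x : ℕ → Fin n → ℕ) (i : Fin m) (p : ℕ) : List Bool :=
  realBits F.dec F.numberBits (P.rhs i) ++ (F.reports P x i p).flatten

open Classical in
/-- The messages of the broadcast: reports in the even steps, answers in the odd steps. -/
def message (P : Program m n) (x : ℕ → Fin n → ℕ) (t : ℕ) :
    Fin n ⊕ Fin m → Fin n ⊕ Fin m → List Bool
  | Sum.inl j, Sum.inr i => if P.matrix i j ≠ 0 ∧ Even t then F.report P x i j (t / 2) else []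
  | Sum.inr i, Sum.inl j => if P.matrix i j ≠ 0 ∧ Odd t then F.answer P x i (t / 2) else []
  | _, _ => []

/-- The broadcast of the values `x P` on the programs `P` of a family. -/
def broadcast (S : Set (Program m n)) (x : Program m n → ℕ → Fin n → ℕ) :
    Transcript S (Fin n ⊕ Fin m) (LocalInput m) where
  network P := network P.1.matrix
  input P := localInput P.1.matrix P.1.rhs P.1.weight
  message P := F.message P.1 (x P.1)
  message_eq_nil P t u v h := by
    rcases u with j | i <;> rcases v with j' | i'
    · rfl
    · exact if_neg fun hA => h (network_adj_inl_inr.2 hA.1)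
    · exact if_neg fun hA => h (network_adj_inr_inl.2 hA.1)
    · rfl

variable {F} {P P' : Program m n} {x x' : ℕ → Fin n → ℕ} {i : Fin m} {j : Fin n} {p : ℕ}

theorem length_report : (F.report P x i j p).length = F.reportLength p := by
  cases p with
  | zero => simp [report, reportLength]; ring
  | succ p => simp [report, reportLength]

theorem length_of_mem_reports : ∀ r ∈ F.reports P x i p, r.length = F.reportLength p := by
  simp [reports, length_report]

theorem length_answer_le :
    (F.answer P x i p).length ≤ 2 * F.numberBits + rowSupport P.matrix * F.reportLength p := by
  rw [answer, List.length_append, length_realBits, length_flatten_of_forall length_of_mem_reports,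
    reports, List.length_map, Finset.length_sort]
  exact Nat.add_le_add_left (Nat.mul_le_mul_right _ (P.card_row_le i)) _

theorem rhs_eq_of_answer_eq (hP : F.Fits P x) (hP' : F.Fits P' x')
    (h : F.answer P x i p = F.answer P' x' i p) : P.rhs i = P'.rhs i :=
  realBits_injOn F.dec F.numberBits (hP.hasCodes.2.1 i) (hP'.hasCodes.2.1 i)
    (List.append_inj h (by simp)).1

theorem reports_eq_of_answer_eq (hpos : 0 < F.reportLength p)
    (h : F.answer P x i p = F.answer P' x' i p) : F.reports P x i p = F.reports P' x' i p :=
  eq_of_flatten_eq hpos length_of_mem_reports length_of_mem_reports (List.append_inj h (by simp)).2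

theorem report_zero_inj (hn : n ≤ 2 ^ F.idBits) (hP : F.Fits P x) (hP' : F.Fits P' x')
    {k k' : Fin n} (h : F.report P x i k 0 = F.report P' x' i k' 0) :
    k = k' ∧ P.matrix i k = P'.matrix i k' ∧ P.weight k = P'.weight k' := by
  obtain ⟨hid, hnumbers⟩ := List.append_inj h (by simp)
  obtain ⟨hcoeff, hweight⟩ := List.append_inj hnumbers (by simp)
  exact ⟨Fin.ext (natBits_injOn _ (k.isLt.trans_le hn) (k'.isLt.trans_le hn) hid),
    realBits_injOn _ _ (hP.hasCodes.1 i k) (hP'.hasCodes.1 i k') hcoeff,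
    realBits_injOn _ _ (hP.hasCodes.2.2 k) (hP'.hasCodes.2.2 k') hweight⟩

theorem row_eq_of_reports_zero_eq (hn : n ≤ 2 ^ F.idBits) (hP : F.Fits P x) (hP' : F.Fits P' x')
    (h : F.reports P x i 0 = F.reports P' x' i 0) :
    (∀ k, P.matrix i k = P'.matrix i k) ∧ ∀ k, P.matrix i k ≠ 0 → P.weight k = P'.weight k := by
  have hdecoded : List.Forall₂
      (fun k k' => k = k' ∧ P.matrix i k = P'.matrix i k' ∧ P.weight k = P'.weight k')
      ((P.row i).sort (· ≤ ·)) ((P'.row i).sort (· ≤ ·)) := by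
    rw [reports, reports, ← List.forall₂_eq_eq_eq, List.forall₂_map_left_iff,
      List.forall₂_map_right_iff] at h
    exact h.imp fun _ _ => report_zero_inj hn hP hP'
  have hsort : (P.row i).sort (· ≤ ·) = (P'.row i).sort (· ≤ ·) := by
    rw [← List.forall₂_eq_eq_eq]
    exact hdecoded.imp fun _ _ hk => hk.1
  have hrow : P.row i = P'.row i := by
    rw [← Finset.sort_toFinset (P.row i) (· ≤ ·), hsort, Finset.sort_toFinset]
  rw [← hsort, List.forall₂_same] at hdecoded
  refine ⟨fun k => ?_, fun k hk => (hdecoded k (by simpa using hk)).2.2⟩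
  by_cases hk : k ∈ P.row i
  · exact (hdecoded k (by simpa using hk)).2.1
  · have hk' := hrow ▸ hk
    rw [Program.mem_row, not_not] at hk hk'
    rw [hk, hk']

theorem value_eq_of_reports_succ_eq (hP : F.Fits P x) (hP' : F.Fits P' x')
    (hrow : ∀ k, P.matrix i k = P'.matrix i k)
    (h : F.reports P x i (p + 1) = F.reports P' x' i (p + 1)) {k : Fin n} (hk : P.matrix i k ≠ 0) :
    x p k = x' p k := by
  have hvars : P'.row i = P.row i := by ext k; simp [hrow]
  rw [reports, reports, hvars] at h
  exact natBits_injOn _ (hP.value_lt p k) (hP'.value_lt p k)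
    (List.map_inj_left.1 h k (by simpa using hk))

section View

variable {S : Set (Program m n)} {x : Program m n → ℕ → Fin n → ℕ} {P P' : S} {t : ℕ}

theorem input_eq_of_sameView (h : (F.broadcast S x).SameView P P' t (Sum.inl j)) :
    P.1.weight j = P'.1.weight j ∧ ∀ i, P.1.matrix i j = P'.1.matrix i j :=
  (LocalInput.ofVariable.inj h.input_eq).imp_right congrFun

theorem answer_eq_of_sameView (h : (F.broadcast S x).SameView P P' t (Sum.inl j))
    (hp : 2 * p + 1 < t) (hij : P.1.matrix i j ≠ 0) :
    F.answer P.1 (x P) i p = F.answer P'.1 (x P') i p := by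
  have hij' : P'.1.matrix i j ≠ 0 := (input_eq_of_sameView h).2 i ▸ hij
  have hphase : (2 * p + 1) / 2 = p := by lia
  have hmessage := h.message_eq _ hp (Sum.inr i)
  simpa [broadcast, message, hij, hij', hphase] using hmessage

theorem sameAround_of_sameView (hn : n ≤ 2 ^ F.idBits) (hpos : 0 < F.reportLength 0)
    (hS : ∀ P ∈ S, F.Fits P (x P)) (ht : 1 < t)
    (h : (F.broadcast S x).SameView P P' t (Sum.inl j)) : P.1.SameAround P'.1 j := by
  have hanswer := fun {i} => answer_eq_of_sameView (p := 0) (i := i) h ht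
  have hrow := fun i hij => row_eq_of_reports_zero_eq hn (hS P P.2) (hS P' P'.2)
    (reports_eq_of_answer_eq hpos (hanswer (i := i) hij))
  exact ⟨(input_eq_of_sameView h).1, (input_eq_of_sameView h).2,
    fun i hij => rhs_eq_of_answer_eq (hS P P.2) (hS P' P'.2) (hanswer hij),
    fun i hij => (hrow i hij).1, fun i hij => (hrow i hij).2⟩

theorem agreeAround_of_sameView (hn : n ≤ 2 ^ F.idBits) (hpos : ∀ p, 0 < F.reportLength p)
    (hS : ∀ P ∈ S, F.Fits P (x P)) (hp : 2 * p + 3 < t)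
    (h : (F.broadcast S x).SameView P P' t (Sum.inl j)) :
    P.1.AgreeAround j (x P p) (x P' p) := fun i hij _ hik =>
  value_eq_of_reports_succ_eq (hS P P.2) (hS P' P'.2)
    ((sameAround_of_sameView hn (hpos 0) hS (by lia) h).row i hij)
    (reports_eq_of_answer_eq (hpos _) (answer_eq_of_sameView h (by lia) hij)) hik

theorem report_eq_of_sameView (hpos : 0 < F.reportLength p)
    (h : (F.broadcast S x).SameView P P' t (Sum.inr i)) (hp : 2 * p < t) (k : Fin n) :
    (P.1.matrix i k ≠ 0 ↔ P'.1.matrix i k ≠ 0) ∧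
      (P.1.matrix i k ≠ 0 → F.report P.1 (x P) i k p = F.report P'.1 (x P') i k p) := by
  have hreport : (if P.1.matrix i k ≠ 0 then F.report P.1 (x P) i k p else [])
      = if P'.1.matrix i k ≠ 0 then F.report P'.1 (x P') i k p else [] := by
    simpa [broadcast, message] using h.message_eq _ hp (Sum.inl k)
  -- a report is never empty, so the constraint knows which variables report to it
  have hne : ∀ (Q : Program m n) y, F.report Q y i k p ≠ [] := fun Q y =>
    List.ne_nil_of_length_pos (length_report.symm ▸ hpos)
  split_ifs at hreport with hk hk' hk'
  · exact ⟨iff_of_true hk hk', fun _ => hreport⟩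
  · exact absurd hreport (hne _ _)
  · exact absurd hreport.symm (hne _ _)
  · exact ⟨iff_of_false hk hk', fun h => absurd h hk⟩

theorem answer_eq_of_sameView_constraint (hpos : 0 < F.reportLength p)
    (h : (F.broadcast S x).SameView P P' t (Sum.inr i)) (hp : 2 * p < t) :
    F.answer P.1 (x P) i p = F.answer P'.1 (x P') i p := by
  have hrhs : P.1.rhs i = P'.1.rhs i := LocalInput.ofConstraint.inj h.input_eq
  have hreport := report_eq_of_sameView hpos h hp
  have hrow : P.1.row i = P'.1.row i := by ext k; simpa using (hreport k).1
  rw [answer, answer, hrhs, reports, reports, hrow, List.map_congr_left fun k hk =>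
    (hreport k).2 ((hreport k).1.2 (by simpa using hk))]

variable {f T : ℕ}

theorem broadcast_isLocal (hn : n ≤ 2 ^ F.idBits) (hpos : ∀ p, 0 < F.reportLength p)
    (hS : ∀ P ∈ S, F.Fits P (x P))
    (hx : ∀ P ∈ S, ∀ P' ∈ S, ∀ j, ∀ p < T, P.SameAround P' j →
      (∀ q < p, P.AgreeAround j (x P q) (x P' q)) → x P p j = x P' p j) :
    (F.broadcast S x).IsLocal (2 * (T + 1)) := by
  intro P P' t v ht h
  funext u
  obtain ⟨p, hp | hp⟩ := Nat.even_or_odd' t <;> subst hp <;> rcases v with j | i <;>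
    rcases u with j' | i' <;> try rfl
  · have hinput := input_eq_of_sameView h
    have hreport : F.report P.1 (x P) i' j p = F.report P'.1 (x P') i' j p := by
      cases p with
      | zero => rw [report, report, hinput.1, hinput.2]
      | succ p =>
        rw [report, report, hx P P.2 P' P'.2 j p (by lia)
          (sameAround_of_sameView hn (hpos 0) hS (by lia) h)
          fun q hq => agreeAround_of_sameView hn hpos hS (by lia) h]
    simp [broadcast, message, hinput.2, hreport]
  · simp [broadcast, message, Nat.not_odd_iff_even.2 (even_two_mul p)]
  · simp [broadcast, message]
  · have hphase : (2 * p + 1) / 2 = p := by lia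
    simp only [broadcast, message, hphase, (report_eq_of_sameView (hpos p) h (by lia) j').1,
      answer_eq_of_sameView_constraint (hpos p) h (by lia)]

theorem broadcast_determines {O : Type} {out : Program m n → Fin n → O} {o : O}
    (hn : n ≤ 2 ^ F.idBits) (hpos : ∀ p, 0 < F.reportLength p) (hS : ∀ P ∈ S, F.Fits P (x P))
    (hout : ∀ P ∈ S, ∀ P' ∈ S, ∀ j, P.SameAround P' j →
      (∀ q < T, P.AgreeAround j (x P q) (x P' q)) → out P j = out P' j) :
    (F.broadcast S x).Determines (2 * (T + 1)) fun P => Sum.elim (out P) fun _ => o := by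
  rintro P P' (j | i) h
  · exact hout P P.2 P' P'.2 j (sameAround_of_sameView hn (hpos 0) hS (by lia) h)
      fun q hq => agreeAround_of_sameView hn hpos hS (by lia) h
  · rfl

theorem length_message_le {bits : ℕ} {L : ℕ → ℕ}
    (hf : ∀ P ∈ S, rowSupport P.matrix ≤ f)
    (hreport : ∀ p ≤ T, F.reportLength p ≤ bits * L (2 * p))
    (hanswer : ∀ p ≤ T, 2 * F.numberBits + f * F.reportLength p ≤ bits * L (2 * p + 1))
    (P : S) (u v : Fin n ⊕ Fin m) (ht : t < 2 * (T + 1)) :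
    ((F.broadcast S x).message P t u v).length ≤ bits * L t := by
  obtain ⟨p, hp | hp⟩ := Nat.even_or_odd' t <;> subst hp <;> rcases u with j | i <;>
    rcases v with j' | i' <;> try exact Nat.zero_le _
  · simp only [broadcast, message]
    split_ifs
    · simpa [length_report] using hreport p (by lia)
    · exact Nat.zero_le _
  · simp [broadcast, message, Nat.not_odd_iff_even.2 (even_two_mul p)]
  · simp [broadcast, message]
  · have hphase : (2 * p + 1) / 2 = p := by lia
    simp only [broadcast, message, hphase]
    split_ifs
    · exact (length_answer_le.trans (Nat.add_le_add_left
        (Nat.mul_le_mul_right _ (hf P P.2)) _)).trans (hanswer p (by lia))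
    · exact Nat.zero_le _

end View

theorem exists_computes_of_broadcast {S : Set (Program m n)} {x : Program m n → ℕ → Fin n → ℕ}
    {out : Program m n → Fin n → ℝ} {f T bits : ℕ} {L : ℕ → ℕ} (hn : n ≤ 2 ^ F.idBits)
    (hpos : ∀ p, 0 < F.reportLength p) (hS : ∀ P ∈ S, F.Fits P (x P))
    (hf : ∀ P ∈ S, rowSupport P.matrix ≤ f) (hL : ∀ t, 0 < L t)
    (hreport : ∀ p ≤ T, F.reportLength p ≤ bits * L (2 * p))
    (hanswer : ∀ p ≤ T, 2 * F.numberBits + f * F.reportLength p ≤ bits * L (2 * p + 1))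
    (hx : ∀ P ∈ S, ∀ P' ∈ S, ∀ j, ∀ p < T, P.SameAround P' j →
      (∀ q < p, P.AgreeAround j (x P q) (x P' q)) → x P p j = x P' p j)
    (hout : ∀ P ∈ S, ∀ P' ∈ S, ∀ j, P.SameAround P' j →
      (∀ q < T, P.AgreeAround j (x P q) (x P' q)) → out P j = out P' j) :
    ∃ alg : DistAlgorithm (Fin n ⊕ Fin m) (LocalInput m) ℝ, ∀ P ∈ S,
      alg.Computes (network P.matrix) (localInput P.matrix P.rhs P.weight) bits
        (startRound L (2 * (T + 1))) (Sum.elim (out P) fun _ => 0) := by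
  obtain ⟨alg, halg⟩ := Transcript.exists_computes_of_length_le hL
    (fun P t u v ht => length_message_le hf hreport hanswer P u v ht)
    (broadcast_isLocal hn hpos hS hx) (broadcast_determines (o := 0) hn hpos hS hout)
  exact ⟨alg, fun P hP => halg ⟨P, hP⟩⟩

end MessageFormat

/-! ## Invariants of Algorithm MWHVC -/

section

variable {V : Type} [DecidableEq V]

namespace Hypergraph

variable {H : Hypergraph V} {C C' : Finset V} {v : V} {e : Finset V}

theorem mem_incident : e ∈ H.incident v ↔ e ∈ H.edges ∧ v ∈ e := by simp [incident]

theorem mem_uncovered : e ∈ H.uncovered C ↔ e ∈ H.edges ∧ Disjoint e C := by simp [uncovered]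

theorem mem_uncoveredAt : e ∈ H.uncoveredAt C v ↔ e ∈ H.uncovered C ∧ v ∈ e := by
  simp [uncoveredAt]

theorem uncovered_anti (h : C ⊆ C') : H.uncovered C' ⊆ H.uncovered C := fun _ he =>
  mem_uncovered.2 ((mem_uncovered.1 he).imp_right (Disjoint.mono_right h))

theorem uncoveredAt_anti (h : C ⊆ C') (v : V) : H.uncoveredAt C' v ⊆ H.uncoveredAt C v :=
  Finset.filter_subset_filter _ (uncovered_anti h)

theorem uncoveredAt_subset_incident (C : Finset V) (v : V) : H.uncoveredAt C v ⊆ H.incident v :=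
  Finset.filter_subset_filter _ (Finset.filter_subset _ _)

theorem mem_edges_of_mem_uncoveredAt (he : e ∈ H.uncoveredAt C v) : e ∈ H.edges :=
  (mem_incident.1 (uncoveredAt_subset_incident C v he)).1

theorem card_incident_pos (he : e ∈ H.edges) (hv : v ∈ e) : 0 < (H.incident v).card :=
  Finset.card_pos.2 ⟨e, mem_incident.2 ⟨he, hv⟩⟩

end Hypergraph

namespace MState

variable {H : Hypergraph V} {w : V → ℝ} {S : MState V} {v : V} {e : Finset V}

/-- The invariants that hold at the end of every iteration. -/
structure Inv (H : Hypergraph V) (w : V → ℝ) (S : MState V) : Prop where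
  deal_pos : ∀ e ∈ H.edges, 0 < S.deal e
  dual_nonneg : ∀ e ∈ H.edges, 0 ≤ S.dual e
  sum_deal_le : ∀ v, ∑ e ∈ H.uncoveredAt S.cover v, S.deal e ≤ (1 / 2) ^ (S.level v + 1) * w v
  load_le : ∀ v, S.load H v ≤ w v * (1 - (1 / 2) ^ (S.level v + 2))
  le_load : ∀ v, w v * (1 - (1 / 2) ^ S.level v) ≤ S.load H v

theorem init_deal (he : e.Nonempty) :
    (init H w).deal e = 1 / 2 * e.inf' he fun v => w v / ((H.incident v).card : ℝ) := by
  simp [init, he]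

theorem init_deal_le (hv : v ∈ e) :
    (init H w).deal e ≤ 1 / 2 * (w v / ((H.incident v).card : ℝ)) := by
  rw [init_deal ⟨v, hv⟩]
  exact mul_le_mul_of_nonneg_left (Finset.inf'_le _ hv) (by norm_num)

theorem init_deal_pos (hw : ∀ v, 0 < w v) (he : e ∈ H.edges) : 0 < (init H w).deal e := by
  rw [init_deal (H.nonempty_of_mem e he)]
  refine mul_pos (by norm_num) ((Finset.lt_inf'_iff _).2 fun v hv => ?_)
  exact div_pos (hw v) (Nat.cast_pos.2 (Hypergraph.card_incident_pos he hv))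

theorem init_load_le (hw : ∀ v, 0 < w v) (v : V) : (init H w).load H v ≤ 1 / 2 * w v := by
  by_cases h : (H.incident v).card = 0
  · rw [load, Finset.card_eq_zero.1 h, Finset.sum_empty]
    exact mul_nonneg (by norm_num) (hw v).le
  · refine (Finset.sum_le_card_nsmul _ _ _ fun e he =>
      init_deal_le (Hypergraph.mem_incident.1 he).2).trans_eq ?_
    rw [nsmul_eq_mul]
    field_simp

theorem Inv.init (hw : ∀ v, 0 < w v) : (MState.init H w).Inv H w := by
  have hpos : ∀ v, ∀ e ∈ H.incident v, 0 ≤ (MState.init H w).deal e := fun v e he =>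
    (init_deal_pos hw (Hypergraph.mem_incident.1 he).1).le
  refine ⟨fun e => init_deal_pos hw, fun e he => (init_deal_pos hw he).le, fun v => ?_, fun v => ?_,
    fun v => ?_⟩ <;> simp only [show (MState.init H w).level v = 0 from rfl]
  · refine (Finset.sum_le_sum_of_subset_of_nonneg (Hypergraph.uncoveredAt_subset_incident _ v)
      fun e he _ => hpos v e he).trans ?_
    simpa using! init_load_le hw v
  · nlinarith [init_load_le (H := H) hw v, hw v]
  · simpa using! Finset.sum_nonneg (hpos v)

theorem load_lt_weight (hS : S.Inv H w) (hw : ∀ v, 0 < w v) (v : V) : S.load H v < w v := by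
  have hgap : 0 < w v * (1 / 2) ^ (S.level v + 2) := mul_pos (hw v) (by positivity)
  linarith [hS.load_le v]

theorem load_nonneg (hS : S.Inv H w) (v : V) : 0 ≤ S.load H v :=
  Finset.sum_nonneg fun e he => hS.dual_nonneg e (Hypergraph.mem_incident.1 he).1

theorem sum_load (S : MState V) (Z : Finset V) :
    ∑ v ∈ Z, S.load H v = ∑ e ∈ H.edges, ((Z ∩ e).card : ℝ) * S.dual e := by
  simp only [load, Hypergraph.incident, Finset.sum_filter]
  rw [Finset.sum_comm]
  refine Finset.sum_congr rfl fun e _ => ?_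
  rw [← Finset.sum_filter, Finset.sum_const, nsmul_eq_mul, Finset.filter_mem_eq_inter]

theorem sum_dual_le (hS : S.Inv H w) (hw : ∀ v, 0 < w v) {Y : Finset V}
    (hY : ∀ e ∈ H.edges, ∃ v ∈ e, v ∈ Y) : ∑ e ∈ H.edges, S.dual e ≤ ∑ v ∈ Y, w v := by
  refine le_trans ?_ (Finset.sum_le_sum fun v _ => (load_lt_weight hS hw v).le)
  rw [sum_load]
  refine Finset.sum_le_sum fun e he => le_mul_of_one_le_left (hS.dual_nonneg e he) ?_
  obtain ⟨v, hv, hvY⟩ := hY e he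
  exact_mod_cast Finset.card_pos.2 ⟨v, Finset.mem_inter.2 ⟨hvY, hv⟩⟩

theorem newLevel_mem (hS : S.Inv H w) {C : Finset V} (h : (H.uncoveredAt C v).Nonempty) :
    S.level v ≤ S.newLevel H w C v ∧
      S.load H v ≤ w v * (1 - (1 / 2) ^ (S.newLevel H w C v + 1)) := by
  rw [newLevel, if_pos h]
  exact Nat.sInf_mem (s := {k | S.level v ≤ k ∧ S.load H v ≤ w v * (1 - (1 / 2) ^ (k + 1))})
    ⟨S.level v + 1, Nat.le_succ _, hS.load_le v⟩

theorem le_newLevel (hS : S.Inv H w) (C : Finset V) (v : V) :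
    S.level v ≤ S.newLevel H w C v := by
  by_cases h : (H.uncoveredAt C v).Nonempty
  · exact (newLevel_mem hS h).1
  · exact (if_neg h).ge

theorem newLevel_le_of_load_le {C : Finset V} {k : ℕ} (hk : S.level v ≤ k)
    (hload : S.load H v ≤ w v * (1 - (1 / 2) ^ (k + 1))) : S.newLevel H w C v ≤ k := by
  rw [newLevel]
  split_ifs
  · exact Nat.sInf_le ⟨hk, hload⟩
  · exact hk

theorem newLevel_le (hS : S.Inv H w) (C : Finset V) (v : V) :
    S.newLevel H w C v ≤ S.level v + 1 :=
  newLevel_le_of_load_le (Nat.le_succ _) (hS.load_le v)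

theorem le_load_newLevel (hS : S.Inv H w) (C : Finset V) (v : V) :
    w v * (1 - (1 / 2) ^ S.newLevel H w C v) ≤ S.load H v := by
  by_contra! hlt
  have hsucc : S.newLevel H w C v ≠ S.level v := fun h => (hS.le_load v).not_gt (h ▸ hlt)
  have hnew : S.newLevel H w C v = S.level v + 1 :=
    (newLevel_le hS C v).antisymm ((le_newLevel hS C v).lt_of_ne' hsucc)
  rw [hnew] at hlt
  exact hsucc ((newLevel_le_of_load_le le_rfl hlt.le).antisymm (le_newLevel hS C v))

end MState

end

section

variable {V : Type} [Fintype V] [DecidableEq V] {H : Hypergraph V} {w : V → ℝ} {β α : ℝ}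
  {S : MState V} {v : V} {e : Finset V}

namespace MState

theorem mem_newCover : v ∈ S.newCover H w β ↔
    v ∈ S.cover ∨ (H.uncoveredAt S.cover v).Nonempty ∧ (1 - β) * w v ≤ S.load H v := by
  simp [newCover]

theorem cover_subset_newCover : S.cover ⊆ S.newCover H w β := Finset.subset_union_left

/-- The deal of `e` after the level increments of its vertices. -/
def scaledDeal (H : Hypergraph V) (w : V → ℝ) (β : ℝ) (S : MState V) (e : Finset V) : ℝ :=
  S.deal e * (1 / 2) ^ (∑ v ∈ e, (S.newLevel H w (S.newCover H w β) v - S.level v))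

/-- `v` sends `raise`. -/
def Raises (H : Hypergraph V) (w : V → ℝ) (β α : ℝ) (S : MState V) (v : V) : Prop :=
  ∑ e ∈ H.uncoveredAt (S.newCover H w β) v, S.scaledDeal H w β e
    ≤ (1 / α) * (1 / 2) ^ (S.newLevel H w (S.newCover H w β) v + 1) * w v

/-- An iteration of the version of Algorithm MWHVC with at most one level increment of a vertex per
iteration. -/
def next (H : Hypergraph V) (w : V → ℝ) (β α : ℝ) (S : MState V) : MState V :=
  S.step H w β α (1 / 2)

@[simp] theorem next_level : (S.next H w β α).level = S.newLevel H w (S.newCover H w β) := rfl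

theorem next_deal_of_raise (he : e ∈ H.uncovered (S.newCover H w β))
    (h : ∀ v ∈ e, S.Raises H w β α v) : (S.next H w β α).deal e = α * S.scaledDeal H w β e :=
  (if_pos he).trans (if_pos h)

theorem next_deal_of_stuck (he : e ∈ H.uncovered (S.newCover H w β))
    (h : ¬ ∀ v ∈ e, S.Raises H w β α v) : (S.next H w β α).deal e = S.scaledDeal H w β e :=
  (if_pos he).trans (if_neg h)

theorem next_deal_of_covered (he : e ∉ H.uncovered (S.newCover H w β)) :
    (S.next H w β α).deal e = S.deal e :=
  if_neg he

theorem next_dual (he : e ∈ H.uncovered (S.newCover H w β)) :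
    (S.next H w β α).dual e = S.dual e + 1 / 2 * (S.next H w β α).deal e :=
  if_pos he

theorem next_dual_of_covered (he : e ∉ H.uncovered (S.newCover H w β)) :
    (S.next H w β α).dual e = S.dual e :=
  if_neg he

theorem scaledDeal_pos (hS : S.Inv H w) (he : e ∈ H.edges) : 0 < S.scaledDeal H w β e :=
  mul_pos (hS.deal_pos e he) (by positivity)

theorem scaledDeal_le (hS : S.Inv H w) (he : e ∈ H.edges) (hv : v ∈ e) :
    S.scaledDeal H w β e
      ≤ S.deal e * (1 / 2) ^ (S.newLevel H w (S.newCover H w β) v - S.level v) :=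
  mul_le_mul_of_nonneg_left (pow_le_pow_of_le_one (by norm_num) (by norm_num)
    (Finset.single_le_sum (f := fun v => S.newLevel H w (S.newCover H w β) v - S.level v)
      (fun _ _ => Nat.zero_le _) hv)) (hS.deal_pos e he).le

theorem scaledDeal_le_next_deal (hα : 1 ≤ α) (hS : S.Inv H w)
    (he : e ∈ H.uncovered (S.newCover H w β)) :
    S.scaledDeal H w β e ≤ (S.next H w β α).deal e := by
  by_cases h : ∀ v ∈ e, S.Raises H w β α v
  · rw [next_deal_of_raise he h]
    exact le_mul_of_one_le_left (scaledDeal_pos hS (Hypergraph.mem_uncovered.1 he).1).le hα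
  · rw [next_deal_of_stuck he h]

theorem next_deal_le (hα : 1 ≤ α) (hS : S.Inv H w) (he : e ∈ H.uncovered (S.newCover H w β)) :
    (S.next H w β α).deal e ≤ α * S.scaledDeal H w β e := by
  by_cases h : ∀ v ∈ e, S.Raises H w β α v
  · rw [next_deal_of_raise he h]
  · rw [next_deal_of_stuck he h]
    exact le_mul_of_one_le_left (scaledDeal_pos hS (Hypergraph.mem_uncovered.1 he).1).le hα

theorem next_deal_pos (hα : 1 ≤ α) (hS : S.Inv H w) (he : e ∈ H.edges) :
    0 < (S.next H w β α).deal e := by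
  by_cases hu : e ∈ H.uncovered (S.newCover H w β)
  · exact (scaledDeal_pos hS he).trans_le (scaledDeal_le_next_deal hα hS hu)
  · rw [next_deal_of_covered hu]
    exact hS.deal_pos e he

theorem dual_le_next_dual (hα : 1 ≤ α) (hS : S.Inv H w) (he : e ∈ H.edges) :
    S.dual e ≤ (S.next H w β α).dual e := by
  by_cases hu : e ∈ H.uncovered (S.newCover H w β)
  · rw [next_dual hu]
    linarith [next_deal_pos (β := β) hα hS he]
  · rw [next_dual_of_covered hu]

theorem load_le_next_load (hα : 1 ≤ α) (hS : S.Inv H w) (v : V) :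
    S.load H v ≤ (S.next H w β α).load H v :=
  Finset.sum_le_sum fun _ he => dual_le_next_dual hα hS (Hypergraph.mem_incident.1 he).1

theorem next_load (S : MState V) (v : V) : (S.next H w β α).load H v
    = S.load H v + 1 / 2 * ∑ e ∈ H.uncoveredAt (S.newCover H w β) v, (S.next H w β α).deal e := by
  have hdual : ∀ e ∈ H.incident v, (S.next H w β α).dual e = S.dual e +
      if e ∈ H.uncoveredAt (S.newCover H w β) v then 1 / 2 * (S.next H w β α).deal e else 0 := by
    intro e he
    have hv := (Hypergraph.mem_incident.1 he).2
    by_cases hu : e ∈ H.uncovered (S.newCover H w β)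
    · rw [next_dual hu, if_pos (Hypergraph.mem_uncoveredAt.2 ⟨hu, hv⟩)]
    · rw [next_dual_of_covered hu, if_neg fun h => hu (Hypergraph.mem_uncoveredAt.1 h).1, add_zero]
  rw [load, load, Finset.sum_congr rfl hdual, Finset.sum_add_distrib, ← Finset.sum_filter,
    Finset.filter_mem_eq_inter,
    Finset.inter_eq_right.2 (Hypergraph.uncoveredAt_subset_incident _ _), Finset.mul_sum]

theorem sum_scaledDeal_le (hS : S.Inv H w) (v : V) :
    ∑ e ∈ H.uncoveredAt (S.newCover H w β) v, S.scaledDeal H w β e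
      ≤ (1 / 2) ^ (S.newLevel H w (S.newCover H w β) v + 1) * w v := by
  set C := S.newCover H w β
  have hlevel := le_newLevel hS C v
  calc ∑ e ∈ H.uncoveredAt C v, S.scaledDeal H w β e
      ≤ ∑ e ∈ H.uncoveredAt C v, S.deal e * (1 / 2) ^ (S.newLevel H w C v - S.level v) :=
        Finset.sum_le_sum fun e he => scaledDeal_le hS
          (Hypergraph.mem_edges_of_mem_uncoveredAt he) (Hypergraph.mem_uncoveredAt.1 he).2
    _ ≤ ∑ e ∈ H.uncoveredAt S.cover v, S.deal e * (1 / 2) ^ (S.newLevel H w C v - S.level v) :=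
        Finset.sum_le_sum_of_subset_of_nonneg
          (Hypergraph.uncoveredAt_anti cover_subset_newCover v) fun e he _ =>
            mul_nonneg (hS.deal_pos e (Hypergraph.mem_edges_of_mem_uncoveredAt he)).le
              (by positivity)
    _ ≤ (1 / 2) ^ (S.level v + 1) * w v * (1 / 2) ^ (S.newLevel H w C v - S.level v) := by
        rw [← Finset.sum_mul]
        exact mul_le_mul_of_nonneg_right (hS.sum_deal_le v) (by positivity)
    _ = (1 / 2) ^ (S.newLevel H w C v + 1) * w v := by
        rw [mul_right_comm, ← pow_add]
        congr 2
        lia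

theorem sum_next_deal_le (hα : 1 ≤ α) (hS : S.Inv H w) (v : V) :
    ∑ e ∈ H.uncoveredAt (S.newCover H w β) v, (S.next H w β α).deal e
      ≤ (1 / 2) ^ (S.newLevel H w (S.newCover H w β) v + 1) * w v := by
  by_cases hr : S.Raises H w β α v
  · calc ∑ e ∈ H.uncoveredAt (S.newCover H w β) v, (S.next H w β α).deal e
        ≤ α * ∑ e ∈ H.uncoveredAt (S.newCover H w β) v, S.scaledDeal H w β e := by
          rw [Finset.mul_sum]
          exact Finset.sum_le_sum fun e he =>
            next_deal_le hα hS (Hypergraph.mem_uncoveredAt.1 he).1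
      _ ≤ α * ((1 / α) * (1 / 2) ^ (S.newLevel H w (S.newCover H w β) v + 1) * w v) :=
          mul_le_mul_of_nonneg_left hr (by linarith)
      _ = (1 / 2) ^ (S.newLevel H w (S.newCover H w β) v + 1) * w v := by field_simp
  · refine (Finset.sum_congr rfl fun e he => ?_).trans_le (sum_scaledDeal_le hS v)
    obtain ⟨hu, hv⟩ := Hypergraph.mem_uncoveredAt.1 he
    exact next_deal_of_stuck hu fun h => hr (h v hv)

theorem Inv.next (hα : 1 ≤ α) (hS : S.Inv H w) : (S.next H w β α).Inv H w where
  deal_pos e he := next_deal_pos hα hS he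
  dual_nonneg e he := (hS.dual_nonneg e he).trans (dual_le_next_dual hα hS he)
  sum_deal_le v := sum_next_deal_le hα hS v
  load_le v := by
    rw [next_load, next_level]
    by_cases h : (H.uncoveredAt (S.newCover H w β) v).Nonempty
    · have hdeal := sum_next_deal_le (β := β) hα hS v
      have hload := (newLevel_mem hS h).2
      rw [pow_succ] at hdeal hload
      rw [pow_add]
      nlinarith
    · rw [Finset.not_nonempty_iff_eq_empty.1 h, Finset.sum_empty, newLevel, if_neg h]
      simpa using hS.load_le v
  le_load v := (le_load_newLevel hS _ v).trans (load_le_next_load hα hS v)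

theorem after_succ (i : ℕ) :
    after H w β α (1 / 2) (i + 1) = (after H w β α (1 / 2) i).next H w β α := by
  rw [after, Function.iterate_succ_apply', next, after]

theorem Inv.after (hα : 1 ≤ α) (hw : ∀ v, 0 < w v) (i : ℕ) :
    (MState.after H w β α (1 / 2) i).Inv H w := by
  induction i with
  | zero => exact Inv.init hw
  | succ i ih => rw [after_succ]; exact ih.next hα

theorem after_cover_mono : Monotone fun i => (after H w β α (1 / 2) i).cover :=
  monotone_nat_of_le_succ fun i => by
    simp only [after_succ]
    exact cover_subset_newCover

/-! ## The approximation ratio of Algorithm MWHVC -/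

theorem le_load_of_mem_cover (hα : 1 ≤ α) (hw : ∀ v, 0 < w v) (i : ℕ)
    (hv : v ∈ (after H w β α (1 / 2) i).cover) :
    (1 - β) * w v ≤ (after H w β α (1 / 2) i).load H v := by
  induction i with
  | zero => simp [after, init] at hv
  | succ i ih =>
    rw [after_succ] at hv ⊢
    have hgrow := load_le_next_load (β := β) hα (Inv.after (H := H) (β := β) hα hw i) v
    exact ((mem_newCover.1 hv).elim ih And.right).trans hgrow

theorem sum_cover_le {f : ℕ} {ε : ℝ} (hε : 0 < ε) (hf : H.RankLE f) (hf0 : 0 < f) (hα : 1 ≤ α)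
    (hw : ∀ v, 0 < w v) (i : ℕ) {Y : Finset V} (hY : ∀ e ∈ H.edges, ∃ v ∈ e, v ∈ Y) :
    ∑ v ∈ (after H w (ε / (f + ε)) α (1 / 2) i).cover, w v ≤ (f + ε) * ∑ v ∈ Y, w v := by
  set S := after H w (ε / (f + ε)) α (1 / 2) i
  have hinv : S.Inv H w := Inv.after hα hw i
  have hf' : (0 : ℝ) < f := Nat.cast_pos.2 hf0
  have hβ : 1 - ε / (f + ε) = f / (f + ε) := by field_simp; ring
  have hprimal : f / (f + ε) * ∑ v ∈ S.cover, w v ≤ f * ∑ v ∈ Y, w v :=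
    calc f / (f + ε) * ∑ v ∈ S.cover, w v
        ≤ ∑ v ∈ S.cover, S.load H v := by
          rw [Finset.mul_sum]
          exact Finset.sum_le_sum fun v hv => hβ ▸ le_load_of_mem_cover hα hw i hv
      _ ≤ f * ∑ e ∈ H.edges, S.dual e := by
          rw [sum_load, Finset.mul_sum]
          refine Finset.sum_le_sum fun e he =>
            mul_le_mul_of_nonneg_right ?_ (hinv.dual_nonneg e he)
          exact_mod_cast (Finset.card_le_card Finset.inter_subset_right).trans (hf e he)
      _ ≤ f * ∑ v ∈ Y, w v := mul_le_mul_of_nonneg_left (sum_dual_le hinv hw hY) hf'.le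
  rw [div_mul_eq_mul_div, div_le_iff₀ (by positivity), mul_assoc] at hprimal
  linarith [le_of_mul_le_mul_left hprimal hf']

end MState

end

/-! ## Termination of Algorithm MWHVC -/

namespace MState

section

variable {V : Type} [DecidableEq V] {H : Hypergraph V} {w : V → ℝ} {S : MState V} {v : V}
  {e : Finset V} {β : ℝ}

/-- The deal of `e`, had its vertices stayed at level `0`. -/
def baseDeal (S : MState V) (e : Finset V) : ℝ :=
  S.deal e * 2 ^ ∑ v ∈ e, S.level v

/-- A potential that increases by at least `1` in each iteration in which `e` remains uncovered. -/
def potential (H : Hypergraph V) (w : V → ℝ) (α : ℝ) (S : MState V) (e : Finset V) : ℝ :=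
  Real.log (S.baseDeal e) / Real.log α - 4 * α * ∑ v ∈ e, Real.log (w v - S.load H v)

theorem baseDeal_pos (hS : S.Inv H w) (he : e ∈ H.edges) : 0 < S.baseDeal e :=
  mul_pos (hS.deal_pos e he) (by positivity)

theorem init_baseDeal : (init H w).baseDeal e = (init H w).deal e := by simp [baseDeal, init]

theorem deal_le (hS : S.Inv H w) (hw : ∀ v, 0 < w v) (he : e ∈ H.uncovered S.cover) (hv : v ∈ e) :
    S.deal e ≤ 1 / 2 * w v :=
  calc S.deal e ≤ ∑ e ∈ H.uncoveredAt S.cover v, S.deal e :=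
        Finset.single_le_sum (f := S.deal)
          (fun e he => (hS.deal_pos e (Hypergraph.mem_edges_of_mem_uncoveredAt he)).le)
          (Hypergraph.mem_uncoveredAt.2 ⟨he, hv⟩)
    _ ≤ (1 / 2) ^ (S.level v + 1) * w v := hS.sum_deal_le v
    _ ≤ 1 / 2 * w v := mul_le_mul_of_nonneg_right
        (pow_le_of_le_one (by norm_num) (by norm_num) (Nat.succ_ne_zero _)) (hw v).le

theorem deal_le_mul_init_deal {D : ℕ} (hS : S.Inv H w) (hw : ∀ v, 0 < w v) (hD : H.DegreeLE D)
    (he : e ∈ H.uncovered S.cover) : S.deal e ≤ D * (init H w).deal e := by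
  have hedge := (Hypergraph.mem_uncovered.1 he).1
  obtain ⟨u, hu, hmin⟩ := Finset.exists_mem_eq_inf' (H.nonempty_of_mem e hedge)
    fun v => w v / ((H.incident v).card : ℝ)
  have hcard : (0 : ℝ) < (H.incident u).card :=
    Nat.cast_pos.2 (Hypergraph.card_incident_pos hedge hu)
  have hdeg : ((H.incident u).card : ℝ) ≤ D := Nat.cast_le.2 (hD u)
  calc S.deal e ≤ 1 / 2 * w u := deal_le hS hw he hu
    _ = (H.incident u).card * (init H w).deal e := by
        rw [init_deal (H.nonempty_of_mem e hedge), hmin]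
        field_simp
    _ ≤ D * (init H w).deal e := mul_le_mul_of_nonneg_right hdeg (init_deal_pos hw hedge).le

theorem level_mul_log_two_le (hS : S.Inv H w) (hw : 0 < w v) (hβ : 0 < β)
    (hslack : β * w v < w v - S.load H v) :
    (S.level v : ℝ) * Real.log 2 ≤ Real.log (1 / β) := by
  have hload := hS.le_load v
  have hpow : β < (1 / 2) ^ S.level v := lt_of_mul_lt_mul_right (by nlinarith) hw.le
  rw [← Real.log_pow]
  refine Real.log_le_log (by positivity) ?_
  rw [le_one_div (by positivity) hβ, ← one_div_pow]
  exact hpow.le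

theorem log_init_slack_sub_le (hw : ∀ v, 0 < w v) (hβ : 0 < β)
    (hslack : β * w v < w v - S.load H v) :
    Real.log (w v - (init H w).load H v) - Real.log (w v - S.load H v) ≤ Real.log (1 / β) := by
  have hinit := load_lt_weight (Inv.init (H := H) hw) hw v
  have hnonneg := load_nonneg (Inv.init (H := H) hw) v
  have hpos := mul_pos hβ (hw v)
  rw [← Real.log_div (by linarith) (by linarith)]
  refine Real.log_le_log (div_pos (by linarith) (by linarith)) ?_
  rw [div_le_div_iff₀ (by linarith) hβ]
  nlinarith

theorem sum_log_init_slack_sub_le {f : ℕ} (hw : ∀ v, 0 < w v) (hβ : 0 < β) (hβ1 : β ≤ 1)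
    (hf : e.card ≤ f) (hslack : ∀ v ∈ e, β * w v < w v - S.load H v) :
    ∑ v ∈ e, Real.log (w v - (init H w).load H v) - ∑ v ∈ e, Real.log (w v - S.load H v)
      ≤ f * Real.log (1 / β) := by
  have hlogβ : 0 ≤ Real.log (1 / β) := Real.log_nonneg ((one_le_div hβ).2 hβ1)
  rw [← Finset.sum_sub_distrib]
  refine (Finset.sum_le_card_nsmul _ _ _ fun v hv =>
    log_init_slack_sub_le hw hβ (hslack v hv)).trans ?_
  rw [nsmul_eq_mul]
  exact mul_le_mul_of_nonneg_right (Nat.cast_le.2 hf) hlogβ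

theorem log_baseDeal_sub_le {f D : ℕ} (hS : S.Inv H w) (hw : ∀ v, 0 < w v) (hβ : 0 < β)
    (hβ1 : β ≤ 1) (hf : e.card ≤ f) (hD : H.DegreeLE D) (he : e ∈ H.uncovered S.cover)
    (hslack : ∀ v ∈ e, β * w v < w v - S.load H v) :
    Real.log (S.baseDeal e) - Real.log ((init H w).baseDeal e)
      ≤ Real.log D + f * Real.log (1 / β) := by
  have hedge := (Hypergraph.mem_uncovered.1 he).1
  have hlogβ : 0 ≤ Real.log (1 / β) := Real.log_nonneg ((one_le_div hβ).2 hβ1)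
  have hdeal := hS.deal_pos e hedge
  have hinit := init_deal_pos hw hedge
  have hle := deal_le_mul_init_deal hS hw hD he
  have hD0 : (D : ℝ) ≠ 0 := fun h => by rw [h, zero_mul] at hle; linarith
  have hlogdeal : Real.log (S.deal e) ≤ Real.log D + Real.log ((init H w).deal e) := by
    rw [← Real.log_mul hD0 hinit.ne']
    exact Real.log_le_log hdeal hle
  have hlevels : Real.log (2 ^ ∑ v ∈ e, S.level v) ≤ f * Real.log (1 / β) := by
    rw [Real.log_pow, Nat.cast_sum, Finset.sum_mul]
    refine (Finset.sum_le_card_nsmul _ _ _ fun v hv =>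
      level_mul_log_two_le hS (hw v) hβ (hslack v hv)).trans ?_
    rw [nsmul_eq_mul]
    exact mul_le_mul_of_nonneg_right (Nat.cast_le.2 hf) hlogβ
  rw [init_baseDeal, baseDeal, Real.log_mul hdeal.ne' (by positivity)]
  linarith

end

variable {V : Type} [Fintype V] [DecidableEq V] {H : Hypergraph V} {w : V → ℝ} {β α : ℝ}
  {S : MState V} {v : V} {e : Finset V}

theorem scaledDeal_mul (hS : S.Inv H w) (e : Finset V) :
    S.scaledDeal H w β e * 2 ^ ∑ v ∈ e, S.newLevel H w (S.newCover H w β) v = S.baseDeal e := by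
  have hlevel : ∑ v ∈ e, S.newLevel H w (S.newCover H w β) v
      = ∑ v ∈ e, (S.newLevel H w (S.newCover H w β) v - S.level v) + ∑ v ∈ e, S.level v := by
    rw [← Finset.sum_add_distrib]
    exact Finset.sum_congr rfl fun v _ => (Nat.sub_add_cancel (le_newLevel hS _ v)).symm
  rw [scaledDeal, baseDeal, hlevel, pow_add, one_div, inv_pow]
  field_simp

theorem next_baseDeal_of_raise (hS : S.Inv H w) (he : e ∈ H.uncovered (S.newCover H w β))
    (h : ∀ v ∈ e, S.Raises H w β α v) : (S.next H w β α).baseDeal e = α * S.baseDeal e := by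
  rw [baseDeal, next_deal_of_raise he h, next_level, ← scaledDeal_mul (β := β) hS e, mul_assoc]

theorem next_baseDeal_of_stuck (hS : S.Inv H w) (he : e ∈ H.uncovered (S.newCover H w β))
    (h : ¬ ∀ v ∈ e, S.Raises H w β α v) : (S.next H w β α).baseDeal e = S.baseDeal e := by
  rw [baseDeal, next_deal_of_stuck he h, next_level, scaledDeal_mul hS e]

theorem next_slack_le_of_stuck (hα : 1 ≤ α) (hS : S.Inv H w) (h : ¬ S.Raises H w β α v) :
    w v - (S.next H w β α).load H v ≤ (w v - S.load H v) * (1 - 1 / (4 * α)) := by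
  have hload := le_load_newLevel hS (S.newCover H w β) v
  have hdeal : ∑ e ∈ H.uncoveredAt (S.newCover H w β) v, S.scaledDeal H w β e
      ≤ ∑ e ∈ H.uncoveredAt (S.newCover H w β) v, (S.next H w β α).deal e :=
    Finset.sum_le_sum fun e he =>
      scaledDeal_le_next_deal hα hS (Hypergraph.mem_uncoveredAt.1 he).1
  rw [Raises, not_le] at h
  rw [next_load]
  set p : ℝ := (1 / 2) ^ S.newLevel H w (S.newCover H w β) v with hp
  rw [pow_succ, ← hp] at h
  have hslack : (w v - S.load H v) * (1 / (4 * α)) ≤ w v * p * (1 / (4 * α)) :=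
    mul_le_mul_of_nonneg_right (by linarith) (by positivity)
  have hraise : w v * p * (1 / (4 * α)) = 1 / 2 * (1 / α * (p * (1 / 2)) * w v) := by
    field_simp
    norm_num
  linarith

theorem log_next_slack_le (hα : 1 ≤ α) (hw : ∀ v, 0 < w v) (hS : S.Inv H w) (v : V) :
    Real.log (w v - (S.next H w β α).load H v) ≤ Real.log (w v - S.load H v) :=
  Real.log_le_log (sub_pos.2 (load_lt_weight (hS.next hα) hw v))
    (sub_le_sub_left (load_le_next_load hα hS v) _)

theorem log_next_slack_le_of_stuck (hα : 1 ≤ α) (hw : ∀ v, 0 < w v) (hS : S.Inv H w)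
    (h : ¬ S.Raises H w β α v) :
    Real.log (w v - (S.next H w β α).load H v) ≤ Real.log (w v - S.load H v) - 1 / (4 * α) := by
  have hfrac : 1 / (4 * α) < 1 := by rw [div_lt_one (by linarith)]; linarith
  refine (Real.log_le_log (sub_pos.2 (load_lt_weight (hS.next hα) hw v))
    (next_slack_le_of_stuck hα hS h)).trans ?_
  rw [Real.log_mul (sub_pos.2 (load_lt_weight hS hw v)).ne' (by linarith)]
  linarith [Real.log_le_sub_one_of_pos (show 0 < 1 - 1 / (4 * α) by linarith)]

theorem potential_add_one_le (hα : 1 < α) (hw : ∀ v, 0 < w v) (hS : S.Inv H w)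
    (he : e ∈ H.uncovered (S.newCover H w β)) :
    S.potential H w α e + 1 ≤ (S.next H w β α).potential H w α e := by
  have hbase := baseDeal_pos hS (Hypergraph.mem_uncovered.1 he).1
  have hlogα : 0 < Real.log α := Real.log_pos hα
  have hlog := log_next_slack_le (β := β) hα.le hw hS
  rw [potential, potential]
  by_cases h : ∀ v ∈ e, S.Raises H w β α v
  · have hsum := Finset.sum_le_sum fun v (_ : v ∈ e) => hlog v
    rw [next_baseDeal_of_raise hS he h, Real.log_mul (by linarith) hbase.ne', add_div,
      div_self hlogα.ne']
    nlinarith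
  · rw [next_baseDeal_of_stuck hS he h]
    push Not at h
    obtain ⟨u, hu, hstuck⟩ := h
    have hsum : ∑ v ∈ e, Real.log (w v - (S.next H w β α).load H v)
        ≤ ∑ v ∈ e, Real.log (w v - S.load H v) - 1 / (4 * α) := by
      rw [← Finset.add_sum_erase e _ hu, ← Finset.add_sum_erase e _ hu]
      linarith [log_next_slack_le_of_stuck hα.le hw hS hstuck,
        Finset.sum_le_sum fun v (_ : v ∈ e.erase u) => hlog v]
    have hgain := mul_le_mul_of_nonneg_left hsum (show 0 ≤ 4 * α by linarith)
    rw [mul_sub, mul_one_div_cancel (by positivity)] at hgain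
    linarith

theorem init_potential_add_le (hα : 1 < α) (hw : ∀ v, 0 < w v) {i : ℕ}
    (he : e ∈ H.uncovered (after H w β α (1 / 2) i).cover) :
    (init H w).potential H w α e + i ≤ (after H w β α (1 / 2) i).potential H w α e := by
  induction i with
  | zero => simp [after]
  | succ i ih =>
    have hprev := ih (Hypergraph.uncovered_anti (after_cover_mono (Nat.le_succ i)) he)
    rw [after_succ] at he ⊢
    have hstep := potential_add_one_le hα hw (Inv.after hα.le hw i) he
    push_cast
    linarith

theorem lt_slack_of_mem_uncovered (he : e ∈ H.uncovered (S.newCover H w β)) (hv : v ∈ e) :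
    β * w v < w v - S.load H v := by
  have hnot : v ∉ S.newCover H w β :=
    Finset.disjoint_left.1 (Hypergraph.mem_uncovered.1 he).2 hv
  rw [mem_newCover] at hnot
  push Not at hnot
  linarith [hnot.2 ⟨e, Hypergraph.mem_uncoveredAt.2
    ⟨Hypergraph.uncovered_anti cover_subset_newCover he, hv⟩⟩]

theorem iteration_le {f D : ℕ} (hα : 1 < α) (hw : ∀ v, 0 < w v) (hβ : 0 < β) (hβ1 : β ≤ 1)
    (hf : H.RankLE f) (hD : H.DegreeLE D) {i : ℕ}
    (he : e ∈ H.uncovered (after H w β α (1 / 2) (i + 1)).cover) :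
    (i : ℝ) ≤ (Real.log D + f * Real.log (1 / β)) / Real.log α
      + 4 * α * (f * Real.log (1 / β)) := by
  have hei := Hypergraph.uncovered_anti (after_cover_mono (Nat.le_succ i)) he
  have hcard := hf e (Hypergraph.mem_uncovered.1 he).1
  have hpotential := init_potential_add_le hα hw hei
  rw [after_succ] at he
  have hslack := fun v (hv : v ∈ e) => lt_slack_of_mem_uncovered he hv
  have hbase := div_le_div_of_nonneg_right
    (log_baseDeal_sub_le (Inv.after hα.le hw i) hw hβ hβ1 hcard hD hei hslack)
    (Real.log_pos hα).le
  have hsum := mul_le_mul_of_nonneg_left (sum_log_init_slack_sub_le hw hβ hβ1 hcard hslack)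
    (show 0 ≤ 4 * α by linarith)
  rw [sub_div] at hbase
  rw [potential, potential] at hpotential
  linarith

end MState

theorem two_le_multiplier (γ : ℝ) (f D : ℕ) (ε : ℝ) : 2 ≤ multiplier γ f D ε := by
  rw [multiplier]
  split_ifs
  · exact le_max_left _ _
  · exact le_rfl

/-- The bound on the number of iterations of Algorithm MWHVC that the potential argument gives. -/
def iterationBound (γ : ℝ) (f D : ℕ) (ε : ℝ) : ℝ :=
  (Real.log D + f * Real.log ((f + ε) / ε)) / Real.log (multiplier γ f D ε)
    + 4 * multiplier γ f D ε * (f * Real.log ((f + ε) / ε))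

theorem mwhvcRounds_le (γ : ℝ) (f D : ℕ) {ε : ℝ} (hε : 0 < ε) :
    mwhvcRounds γ f D ε ≤ ((2 + 4 * (⌊iterationBound γ f D ε⌋₊ + 2) : ℕ) : ℕ∞) := by
  refine iSup_le fun k => iSup_le fun H => iSup_le fun w => iSup_le fun ⟨hf, hD, hw⟩ => ?_
  refine iInf_le_of_le (⌊iterationBound γ f D ε⌋₊ + 2) (iInf_le_of_le ?_ le_rfl)
  by_contra! hne
  obtain ⟨e, he⟩ := hne
  have hiter := MState.iteration_le (one_lt_two.trans_le (two_le_multiplier γ f D ε)) hw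
    (by positivity) (div_le_one_of_le₀ (by simp) (by positivity)) hf hD he
  rw [one_div_div, ← iterationBound] at hiter
  push_cast at hiter
  linarith [Nat.lt_floor_add_one (iterationBound γ f D ε)]

/-! ## The closed form of the round bound -/

section ClosedBound

variable {γ ε X G : ℝ} {f D : ℕ}

theorem one_lt_log_of_three_le (hD : 3 ≤ D) : 1 < Real.log D := by
  rw [Real.lt_log_iff_exp_lt (by positivity)]
  have : (3 : ℝ) ≤ D := by exact_mod_cast hD
  linarith [Real.exp_one_lt_d9]

theorem mul_log_div_nonneg (f : ℕ) (hε : 0 < ε) (hε1 : ε ≤ 1) : 0 ≤ f * Real.log (f / ε) := by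
  rcases f.eq_zero_or_pos with rfl | hf
  · simp
  · have hf1 : (1 : ℝ) ≤ f := by exact_mod_cast hf
    have : 1 ≤ f / ε := by rw [le_div_iff₀ hε]; linarith
    have := Real.log_nonneg this
    positivity

theorem two_le_div_of_le_one (hf : 2 ≤ f) (hε : 0 < ε) (hε1 : ε ≤ 1) : 2 ≤ (f : ℝ) / ε := by
  have : (2 : ℝ) ≤ f := by exact_mod_cast hf
  rw [le_div_iff₀ hε]
  linarith

theorem one_lt_mul_log_div (hf : 2 ≤ f) (hε : 0 < ε) (hε1 : ε ≤ 1) :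
    1 < f * Real.log (f / ε) := by
  have hf2 : (2 : ℝ) ≤ f := by exact_mod_cast hf
  have hlog : Real.log 2 ≤ Real.log (f / ε) :=
    Real.log_le_log two_pos (two_le_div_of_le_one hf hε hε1)
  nlinarith [Real.log_two_gt_d9]

theorem log_add_div_le (hf : 2 ≤ f) (hε : 0 < ε) (hε1 : ε ≤ 1) :
    Real.log ((f + ε) / ε) ≤ 2 * Real.log (f / ε) := by
  have h2 := two_le_div_of_le_one hf hε hε1
  rw [add_div, div_self hε.ne', ← Nat.cast_two, ← Real.log_pow]
  exact Real.log_le_log (by linarith) (by nlinarith)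

theorem div_log_max_two_le {q : ℝ} (hγ : 0 < γ) (hX : 1 < X) (hq : X ^ (γ / 2) ≤ q) :
    X / Real.log (max 2 q) ≤ 2 / γ * (X / Real.log X) := by
  have hlogX := Real.log_pos hX
  have hlog : γ / 2 * Real.log X ≤ Real.log (max 2 q) := by
    rw [← Real.log_rpow (by linarith)]
    exact Real.log_le_log (by positivity) (hq.trans (le_max_right _ _))
  calc X / Real.log (max 2 q) ≤ X / (γ / 2 * Real.log X) := by gcongr
    _ = 2 / γ * (X / Real.log X) := by field_simp

theorem le_mul_min_of_div_lt_rpow (hγ : 0 < γ) (hX : 1 < X) (hG : 0 < G)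
    (hq : X / (G * Real.log X) < X ^ (γ / 2)) : X ≤ (1 + 2 / γ) * min X (G * X ^ γ) := by
  have hlogX := Real.log_pos hX
  have hXγ : X ^ (γ / 2) * X ^ (γ / 2) = X ^ γ := by
    rw [← Real.rpow_add (by linarith), add_halves]
  have hle : X ≤ 2 / γ * (G * X ^ γ) :=
    calc X ≤ X ^ (γ / 2) * (G * Real.log X) := ((div_lt_iff₀ (by positivity)).1 hq).le
      _ ≤ X ^ (γ / 2) * (G * (X ^ (γ / 2) / (γ / 2))) := by
        gcongr
        exact Real.log_le_rpow_div (by linarith) (by positivity)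
      _ = 2 / γ * (G * X ^ γ) := by rw [← hXγ]; field_simp
  have hγ2 : 0 < 2 / γ := by positivity
  have hGX : 0 < G * X ^ γ := by positivity
  rcases min_choice X (G * X ^ γ) with h | h <;> rw [h] <;> nlinarith

theorem log_div_log_multiplier_le (hγ : 0 < γ) (hf : 2 ≤ f) (hD : 3 ≤ D) (hε : 0 < ε)
    (hε1 : ε ≤ 1) :
    Real.log D / Real.log (multiplier γ f D ε) ≤ (2 + 4 / γ) *
      (Real.log D / Real.log (Real.log D)
        + min (Real.log D) (f * Real.log (f / ε) * Real.log D ^ γ)) := by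
  have hX := one_lt_log_of_three_le hD
  have hlogX := Real.log_pos hX
  have hG := one_lt_mul_log_div hf hε hε1
  unfold multiplier
  set X := Real.log D
  set G := f * Real.log (f / ε)
  have hratio : 0 < X / Real.log X := by positivity
  have hmin : 0 < min X (G * X ^ γ) := lt_min (by linarith) (by positivity)
  have hγ4 : 4 / γ = 2 * (2 / γ) := by ring
  have hγ2 : 0 < 2 / γ := by positivity
  simp only
  split_ifs with hq
  · have := div_log_max_two_le hγ hX hq
    rw [hγ4]
    nlinarith [mul_pos hγ2 hmin, mul_pos hγ2 hratio]
  · have hle := le_mul_min_of_div_lt_rpow hγ hX (by linarith) (not_le.1 hq)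
    have hlog2 : X / Real.log 2 ≤ 2 * X := by
      rw [div_le_iff₀ (by positivity)]
      nlinarith [Real.log_two_gt_d9]
    rw [hγ4]
    nlinarith [mul_pos hγ2 hratio]

theorem multiplier_mul_le (hf : 2 ≤ f) (hD : 3 ≤ D) (hε : 0 < ε) (hε1 : ε ≤ 1) :
    multiplier γ f D ε * (f * Real.log (f / ε))
      ≤ 2 * (f * Real.log (f / ε)) + Real.log D / Real.log (Real.log D) := by
  have hX := one_lt_log_of_three_le hD
  have hlogX := Real.log_pos hX
  have hG := one_lt_mul_log_div hf hε hε1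
  unfold multiplier
  set X := Real.log D
  set G := f * Real.log (f / ε)
  have hratio : 0 < X / (G * Real.log X) := by positivity
  calc _ ≤ (2 + X / (G * Real.log X)) * G := by
        gcongr
        simp only
        split_ifs
        · exact max_le (by linarith) (by linarith)
        · linarith
    _ = 2 * G + X / Real.log X := by field_simp

theorem iterationBound_le_closedBound (hγ : 0 < γ) (hf : 2 ≤ f) (hD : 3 ≤ D) (hε : 0 < ε)
    (hε1 : ε ≤ 1) : iterationBound γ f D ε ≤ (19 + 4 / γ) * closedBound γ f D ε := by
  have hX := one_lt_log_of_three_le hD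
  have hG := one_lt_mul_log_div hf hε hε1
  have hdiv := log_div_log_multiplier_le hγ hf hD hε hε1
  have hmul := multiplier_mul_le (γ := γ) hf hD hε hε1
  have hα := two_le_multiplier γ f D ε
  have hlogα : Real.log 2 ≤ Real.log (multiplier γ f D ε) := Real.log_le_log two_pos hα
  have hL : f * Real.log ((f + ε) / ε) ≤ 2 * (f * Real.log (f / ε)) := by
    have := mul_le_mul_of_nonneg_left (log_add_div_le hf hε hε1) f.cast_nonneg
    linarith
  unfold iterationBound closedBound
  set X := Real.log D
  set G := f * Real.log (f / ε)
  set α := multiplier γ f D ε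
  have hlog2 := Real.log_two_gt_d9
  have hlogα0 : 0 < Real.log α := by linarith
  have hratio : 0 < X / Real.log X := div_pos (by linarith) (Real.log_pos hX)
  have hmin : 0 < min X (G * X ^ γ) := lt_min (by linarith) (by positivity)
  have hGlog : 2 * G / Real.log α ≤ 3 * G := by
    rw [div_le_iff₀ hlogα0]
    nlinarith
  calc (X + f * Real.log ((f + ε) / ε)) / Real.log α
        + 4 * α * (f * Real.log ((f + ε) / ε))
      ≤ (X + 2 * G) / Real.log α + 4 * α * (2 * G) := by gcongr
    _ = X / Real.log α + 2 * G / Real.log α + 8 * (α * G) := by ring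
    _ ≤ (2 + 4 / γ) * (X / Real.log X + min X (G * X ^ γ)) + 3 * G
        + 8 * (2 * G + X / Real.log X) := by gcongr
    _ ≤ (19 + 4 / γ) * (G + X / Real.log X + min X (G * X ^ γ)) := by
      have : 0 < 4 / γ := by positivity
      nlinarith

theorem one_le_closedBound (γ : ℝ) (f : ℕ) (hD : 3 ≤ D) (hε : 0 < ε) (hε1 : ε ≤ 1) :
    1 ≤ closedBound γ f D ε := by
  have hX := one_lt_log_of_three_le hD
  have hG := mul_log_div_nonneg f hε hε1
  have hratio : 1 ≤ Real.log D / Real.log (Real.log D) := by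
    rw [le_div_iff₀ (Real.log_pos hX)]
    linarith [Real.log_le_sub_one_of_pos (show 0 < Real.log D by linarith)]
  have hmin : 0 ≤ min (Real.log D) (f * Real.log (f / ε) * Real.log D ^ γ) :=
    le_min (by linarith) (by positivity)
  unfold closedBound
  linarith

theorem exists_mwhvcRounds_eq (hγ : 0 < γ) (hf : 2 ≤ f) (hD : 3 ≤ D) (hε : 0 < ε)
    (hε1 : ε ≤ 1) :
    ∃ T : ℕ, mwhvcRounds γ f D ε = T ∧ (T : ℝ) ≤ (86 + 16 / γ) * closedBound γ f D ε := by
  have hle := mwhvcRounds_le γ f D hε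
  obtain ⟨T, hT⟩ := ENat.ne_top_iff_exists.1 (ne_top_of_le_ne_top (ENat.natCast_ne_top _) hle)
  refine ⟨T, hT.symm, ?_⟩
  rw [← hT, Nat.cast_le] at hle
  have hone := one_le_closedBound γ f hD hε hε1
  have hfloor : (⌊iterationBound γ f D ε⌋₊ : ℝ) ≤ (19 + 4 / γ) * closedBound γ f D ε := by
    have hbound := iterationBound_le_closedBound hγ hf hD hε hε1
    rcases le_total 0 (iterationBound γ f D ε) with h | h
    · exact (Nat.floor_le h).trans hbound
    · rw [Nat.floor_of_nonpos h, Nat.cast_zero]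
      positivity
  calc (T : ℝ) ≤ 2 + 4 * (⌊iterationBound γ f D ε⌋₊ + 2) := by exact_mod_cast hle
    _ ≤ 10 * closedBound γ f D ε + 4 * ((19 + 4 / γ) * closedBound γ f D ε) := by linarith
    _ = (86 + 16 / γ) * closedBound γ f D ε := by ring

end ClosedBound

/-! ## A lower bound on the number of rounds of Algorithm MWHVC -/

section LowerBound

namespace MState

variable {V : Type} [Fintype V] [DecidableEq V] {H : Hypergraph V} {w : V → ℝ} {β α : ℝ}
  {S : MState V} {e : Finset V} {v : V}

theorem next_deal_le_mul (hα : 1 ≤ α) (hS : S.Inv H w) (he : e ∈ H.edges) :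
    (S.next H w β α).deal e ≤ α * S.deal e := by
  have hpos := hS.deal_pos e he
  by_cases hu : e ∈ H.uncovered (S.newCover H w β)
  · have hscaled : S.scaledDeal H w β e ≤ S.deal e :=
      mul_le_of_le_one_right hpos.le (pow_le_one₀ (by norm_num) (by norm_num))
    exact (next_deal_le hα hS hu).trans (by gcongr)
  · rw [next_deal_of_covered hu]
    exact le_mul_of_one_le_left hpos.le hα

theorem after_deal_le (hα : 1 ≤ α) (hw : ∀ v, 0 < w v) (i : ℕ) (he : e ∈ H.edges) :
    (after H w β α (1 / 2) i).deal e ≤ α ^ i * (init H w).deal e := by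
  induction i with
  | zero => simp [after]
  | succ i ih =>
    rw [after_succ, pow_succ', mul_assoc]
    exact (next_deal_le_mul hα (Inv.after hα hw i) he).trans (by gcongr)

theorem after_dual_le (hα : 1 ≤ α) (hw : ∀ v, 0 < w v) (i : ℕ) (he : e ∈ H.edges) :
    (after H w β α (1 / 2) i).dual e ≤ (1 + α) ^ i * (init H w).deal e := by
  have hpos := init_deal_pos hw he
  induction i with
  | zero => simp [after, init]
  | succ i ih =>
    have hinv : (after H w β α (1 / 2) i).Inv H w := Inv.after hα hw i
    have hdeal : ((after H w β α (1 / 2) i).next H w β α).deal e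
        ≤ α * ((1 + α) ^ i * (init H w).deal e) :=
      calc _ ≤ α * (after H w β α (1 / 2) i).deal e := next_deal_le_mul hα hinv he
        _ ≤ α * (α ^ i * (init H w).deal e) := by gcongr; exact after_deal_le hα hw i he
        _ ≤ α * ((1 + α) ^ i * (init H w).deal e) := by gcongr; linarith
    have hnext := next_deal_pos (β := β) hα hinv he
    rw [after_succ, pow_succ']
    by_cases hu : e ∈ H.uncovered ((after H w β α (1 / 2) i).newCover H w β)
    · rw [next_dual hu]
      linarith
    · rw [next_dual_of_covered hu]
      linarith

theorem notMem_after_cover (hα : 1 ≤ α) (hw : ∀ v, 0 < w v) {i : ℕ}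
    (h : (1 + α) ^ i * ∑ e ∈ H.incident v, (init H w).deal e < (1 - β) * w v) :
    v ∉ (after H w β α (1 / 2) i).cover := by
  refine fun hv => h.not_ge ((le_load_of_mem_cover hα hw i hv).trans ?_)
  rw [load, Finset.mul_sum]
  exact Finset.sum_le_sum fun e he => after_dual_le hα hw i (Hypergraph.mem_incident.1 he).1

end MState

/-- The star with center `0`, in which the center itself is an additional hyperedge `{0}`. -/
def starHypergraph (D : ℕ) [NeZero D] : Hypergraph (Fin D) where
  edges := Finset.univ.image fun j => {0, j}
  nonempty_of_mem e he := by
    obtain ⟨j, -, rfl⟩ := Finset.mem_image.1 he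
    exact ⟨0, by simp⟩

/-- Weights of the star for which the initial deals at the center are as small as its degree
permits: its leaves are so light that they join the cover only with negligible dual variables. -/
def starWeight (D : ℕ) [NeZero D] (v : Fin D) : ℝ :=
  if v = 0 then 1 else 1 / (D : ℝ) ^ 2

section Star

variable (D : ℕ) [NeZero D]

theorem starWeight_pos (v : Fin D) : 0 < starWeight D v := by
  have := NeZero.pos D
  unfold starWeight
  split_ifs <;> positivity

theorem card_starHypergraph_edges : (starHypergraph D).edges.card = D := by
  have hinj : Function.Injective fun j : Fin D => ({0, j} : Finset (Fin D)) := fun j k h => by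
    have hj : j = 0 ∨ j = k := by simpa using h.subset (by simp : j ∈ ({0, j} : Finset _))
    have hk : k = 0 ∨ k = j := by simpa using h.superset (by simp : k ∈ ({0, k} : Finset _))
    lia
  rw [starHypergraph, Finset.card_image_of_injective _ hinj, Finset.card_univ, Fintype.card_fin]

theorem starHypergraph_incident_zero :
    (starHypergraph D).incident 0 = (starHypergraph D).edges := by
  refine Finset.filter_true_of_mem fun e he => ?_
  obtain ⟨j, -, rfl⟩ := Finset.mem_image.1 he
  simp

theorem starHypergraph_rankLE_two : (starHypergraph D).RankLE 2 := by
  intro e he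
  obtain ⟨j, -, rfl⟩ := Finset.mem_image.1 he
  exact Finset.card_le_two

theorem starHypergraph_degreeLE : (starHypergraph D).DegreeLE D := fun _ =>
  (Finset.card_le_card (Finset.filter_subset _ _)).trans_eq (card_starHypergraph_edges D)

theorem singleton_zero_mem_starHypergraph : {0} ∈ (starHypergraph D).edges :=
  Finset.mem_image.2 ⟨0, by simp⟩

theorem starHypergraph_init_deal_le {e : Finset (Fin D)} (he : e ∈ (starHypergraph D).edges)
    (hne : e ≠ {0}) :
    (MState.init (starHypergraph D) (starWeight D)).deal e ≤ 1 / 2 * (1 / (D : ℝ) ^ 2) := by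
  obtain ⟨j, -, rfl⟩ := Finset.mem_image.1 he
  have hj : j ≠ 0 := fun hj => hne (by simp [hj])
  have hjmem : j ∈ ({0, j} : Finset (Fin D)) := by simp
  have hcard : (1 : ℝ) ≤ ((starHypergraph D).incident j).card := by
    exact_mod_cast Hypergraph.card_incident_pos he hjmem
  refine (MState.init_deal_le hjmem).trans ?_
  rw [starWeight, if_neg hj]
  exact mul_le_mul_of_nonneg_left (div_le_self (by positivity) hcard) (by norm_num)

theorem starHypergraph_sum_init_deal_le :
    ∑ e ∈ (starHypergraph D).incident 0, (MState.init (starHypergraph D) (starWeight D)).deal e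
      ≤ 1 / D := by
  have hD : (0 : ℝ) < D := Nat.cast_pos.2 (NeZero.pos D)
  have hcenter : (MState.init (starHypergraph D) (starWeight D)).deal {0} ≤ 1 / 2 * (1 / D) := by
    refine (MState.init_deal_le (v := 0) (by simp)).trans_eq ?_
    rw [starHypergraph_incident_zero, card_starHypergraph_edges, starWeight, if_pos rfl]
  rw [starHypergraph_incident_zero,
    ← Finset.add_sum_erase _ _ (singleton_zero_mem_starHypergraph D)]
  calc _ ≤ 1 / 2 * (1 / (D : ℝ)) + ((starHypergraph D).edges.erase {0}).card
        • (1 / 2 * (1 / (D : ℝ) ^ 2)) := by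
        gcongr
        exact Finset.sum_le_card_nsmul _ _ _ fun e he =>
          starHypergraph_init_deal_le D (Finset.mem_of_mem_erase he) (Finset.ne_of_mem_erase he)
    _ ≤ 1 / 2 * (1 / (D : ℝ)) + D • (1 / 2 * (1 / (D : ℝ) ^ 2)) := by
        gcongr
        exact Finset.card_erase_le.trans_eq (card_starHypergraph_edges D)
    _ = 1 / D := by rw [nsmul_eq_mul]; field_simp; norm_num

end Star

section Rounds

variable {γ ε : ℝ} {f D i : ℕ}

theorem le_mwhvcRounds_of_uncovered_nonempty {k : ℕ} {H : Hypergraph (Fin k)} {w : Fin k → ℝ}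
    (hf : H.RankLE f) (hD : H.DegreeLE D) (hw : ∀ v, 0 < w v)
    (h : (H.uncovered
      (MState.after H w (ε / (f + ε)) (multiplier γ f D ε) (1 / 2) i).cover).Nonempty) :
    ((2 + 4 * (i + 1) : ℕ) : ℕ∞) ≤ mwhvcRounds γ f D ε := by
  refine le_iSup_of_le k (le_iSup_of_le H (le_iSup_of_le w (le_iSup_of_le ⟨hf, hD, hw⟩
    (le_iInf fun l => le_iInf fun hl => ?_))))
  rw [Nat.cast_le]
  by_contra! hlt
  have hli : l ≤ i := by lia
  exact (h.mono (Hypergraph.uncovered_anti (MState.after_cover_mono hli))).ne_empty hl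

theorem le_mwhvcRounds (hf : 2 ≤ f) (hD : 0 < D) (hε : 0 < ε) (hε1 : ε ≤ 1)
    (hi : (1 + multiplier γ f D ε) ^ i ≤ (D : ℝ) / 2) :
    ((2 + 4 * (i + 1) : ℕ) : ℕ∞) ≤ mwhvcRounds γ f D ε := by
  have : NeZero D := ⟨hD.ne'⟩
  have hf' : (2 : ℝ) ≤ f := by exact_mod_cast hf
  have hα := two_le_multiplier γ f D ε
  have hβ : ε / (f + ε) < 1 / 2 := by
    rw [div_lt_div_iff₀ (by linarith) two_pos]
    linarith
  have hcenter : 0 ∉ (MState.after (starHypergraph D) (starWeight D) (ε / (f + ε))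
      (multiplier γ f D ε) (1 / 2) i).cover := by
    refine MState.notMem_after_cover (by linarith) (starWeight_pos D) ?_
    calc _ ≤ (1 + multiplier γ f D ε) ^ i * (1 / D) := by
          gcongr
          exact starHypergraph_sum_init_deal_le D
      _ ≤ (D : ℝ) / 2 * (1 / D) := by gcongr
      _ = 1 / 2 := by field_simp
      _ < (1 - ε / (f + ε)) * starWeight D 0 := by
        rw [starWeight, if_pos rfl]
        linarith
  refine le_mwhvcRounds_of_uncovered_nonempty
    (fun e he => (starHypergraph_rankLE_two D e he).trans hf) (starHypergraph_degreeLE D)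
    (starWeight_pos D) ⟨{0}, Hypergraph.mem_uncovered.2
      ⟨singleton_zero_mem_starHypergraph D, ?_⟩⟩
  rwa [Finset.disjoint_singleton_left]

theorem two_le_mwhvcRounds (γ : ℝ) (f D : ℕ) (ε : ℝ) : 2 ≤ mwhvcRounds γ f D ε := by
  let H : Hypergraph (Fin 0) := ⟨∅, by simp⟩
  have hH : H.RankLE f ∧ H.DegreeLE D ∧ ∀ _ : Fin 0, 0 < (1 : ℝ) :=
    ⟨by simp [H, Hypergraph.RankLE], fun v => v.elim0, fun v => v.elim0⟩
  refine le_iSup_of_le 0 (le_iSup_of_le H (le_iSup_of_le _ (le_iSup_of_le hH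
    (le_iInf fun i => le_iInf fun _ => ?_))))
  exact_mod_cast Nat.le_add_right 2 (4 * i)

theorem mul_log_two_le_log (hD : 2 ^ f ≤ D) : f * Real.log 2 ≤ Real.log D := by
  rw [← Real.log_pow]
  exact Real.log_le_log (by positivity) (by exact_mod_cast hD)

theorem mul_log_one_add_multiplier_le (hf : 2 ≤ f) (hD : 2 ^ f ≤ D) (hε : 0 < ε) (hε1 : ε ≤ 1) :
    f * Real.log (1 + multiplier γ f D ε) ≤ 6 * Real.log D := by
  have hf' : (2 : ℝ) ≤ f := by exact_mod_cast hf
  have hlog2 := Real.log_two_gt_d9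
  have hX := mul_log_two_le_log hD
  unfold multiplier
  set X := Real.log D
  set L := Real.log (f / ε)
  set q := X / (f * L * Real.log X) with hq
  have hL : Real.log 2 ≤ L := Real.log_le_log two_pos (two_le_div_of_le_one hf hε hε1)
  have hL0 : 0 < L := by linarith
  have hX4 : 4 / 3 ≤ X := by nlinarith
  have hlogX : 1 / 4 ≤ Real.log X := by
    have := Real.one_sub_inv_le_log_of_pos (show 0 < X by linarith)
    have := inv_anti₀ (by norm_num) hX4
    linarith
  have htwo : f * Real.log (1 + 2) ≤ 6 * X := by
    have hlog3 : Real.log (1 + 2) ≤ 2 * Real.log 2 := by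
      rw [← Nat.cast_two, ← Real.log_pow]
      exact Real.log_le_log (by norm_num) (by norm_num)
    nlinarith
  have hratio : f * Real.log (1 + q) ≤ 6 * X := by
    have hprod : 1 / 6 ≤ L * Real.log X := by nlinarith
    have hq0 : 0 < q := by positivity
    have hqX : f * q * (L * Real.log X) = X := by rw [hq]; field_simp
    calc f * Real.log (1 + q) ≤ f * q := by
          gcongr
          linarith [Real.log_le_sub_one_of_pos (show 0 < 1 + q by linarith)]
      _ ≤ 6 * (f * q * (L * Real.log X)) := by nlinarith [mul_pos (by linarith : 0 < (f : ℝ)) hq0]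
      _ = 6 * X := by rw [hqX]
  simp only
  split_ifs
  · rcases max_choice 2 q with h | h <;> rwa [h]
  · exact htwo

theorem rank_le_mwhvcRounds {T : ℕ} (hf : 2 ≤ f) (hD : 2 ^ f ≤ D) (hε : 0 < ε) (hε1 : ε ≤ 1)
    (hT : mwhvcRounds γ f D ε = T) : f ≤ 3 * T := by
  have hα := two_le_multiplier γ f D ε
  have hlog := mul_log_one_add_multiplier_le (γ := γ) hf hD hε hε1
  have hX := mul_log_two_le_log hD
  have hf' : (2 : ℝ) ≤ f := by exact_mod_cast hf
  have hDpos : 0 < D := (pow_pos two_pos f).trans_le hD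
  have hD2 : 1 ≤ (D : ℝ) / 2 := by
    have : 2 ≤ D := (Nat.le_self_pow (by lia) 2).trans hD
    rw [le_div_iff₀ two_pos]
    exact_mod_cast this
  obtain ⟨k, hk, hk1⟩ := exists_nat_pow_near hD2
    (show 1 < 1 + multiplier γ f D ε by linarith)
  have hTk := le_mwhvcRounds hf hDpos hε hε1 hk
  rw [hT, Nat.cast_le] at hTk
  set a := Real.log (1 + multiplier γ f D ε)
  have ha : 0 < a := Real.log_pos (by linarith)
  have hlogD : Real.log D - Real.log 2 ≤ (k + 1) * a := by
    have := Real.log_le_log (by positivity) hk1.le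
    rwa [Real.log_div (by positivity) two_ne_zero, Real.log_pow, Nat.cast_succ] at this
  have hfk : f * a ≤ (12 * (k + 1)) * a := by nlinarith [Real.log_pos one_lt_two]
  have hfk' : f ≤ 12 * (k + 1) := by exact_mod_cast le_of_mul_le_mul_right hfk ha
  lia

end Rounds

end LowerBound

/-! ## Locality of Algorithm MWHVC -/

section Locality

variable {V : Type} [DecidableEq V]

namespace Hypergraph

variable {H H' : Hypergraph V} {v : V} {C C' e : Finset V}

/-- The vertices that share a hyperedge with `v`, together with `v` itself. -/
def closedNeighborhood (H : Hypergraph V) (v : V) : Set V :=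
  {u | u = v ∨ ∃ e ∈ H.incident v, u ∈ e}

theorem self_mem_closedNeighborhood (H : Hypergraph V) (v : V) : v ∈ H.closedNeighborhood v :=
  Or.inl rfl

theorem mem_closedNeighborhood_of_mem {u : V} (he : e ∈ H.incident v) (hu : u ∈ e) :
    u ∈ H.closedNeighborhood v :=
  Or.inr ⟨e, he, hu⟩

theorem mem_uncovered_congr (hinc : H.incident v = H'.incident v)
    (hC : ∀ u ∈ H.closedNeighborhood v, u ∈ C ↔ u ∈ C') (he : e ∈ H.incident v) :
    e ∈ H.uncovered C ↔ e ∈ H'.uncovered C' := by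
  have hdisj : Disjoint e C ↔ Disjoint e C' := by
    simp only [Finset.disjoint_left]
    exact forall₂_congr fun u hu => not_congr (hC u (mem_closedNeighborhood_of_mem he hu))
  simp only [mem_uncovered, hdisj, (mem_incident.1 he).1, (mem_incident.1 (hinc ▸ he)).1]

theorem uncoveredAt_congr (hinc : H.incident v = H'.incident v)
    (hC : ∀ u ∈ H.closedNeighborhood v, u ∈ C ↔ u ∈ C') :
    H.uncoveredAt C v = H'.uncoveredAt C' v := by
  have hmem : ∀ e, e ∈ H.edges ∧ v ∈ e ↔ e ∈ H'.edges ∧ v ∈ e := fun e => by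
    rw [← mem_incident, ← mem_incident, hinc]
  ext e
  rw [mem_uncoveredAt, mem_uncoveredAt]
  constructor
  · rintro ⟨he, hv⟩
    exact ⟨(mem_uncovered_congr hinc hC
      (mem_incident.2 ⟨(mem_uncovered.1 he).1, hv⟩)).1 he, hv⟩
  · rintro ⟨he, hv⟩
    exact ⟨(mem_uncovered_congr hinc hC
      (mem_incident.2 ((hmem e).2 ⟨(mem_uncovered.1 he).1, hv⟩))).2 he, hv⟩

end Hypergraph

namespace MState

variable {H H' : Hypergraph V} {w w' : V → ℝ} {β α : ℝ} {S S' : MState V} {v : V}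
  {e : Finset V}

/-- Two states agree on the closed neighbourhood of `v` and on the hyperedges containing `v`, that
is, on everything that an iteration reads and writes at `v`. -/
structure AgreeAt (H : Hypergraph V) (v : V) (S S' : MState V) : Prop where
  cover : ∀ u ∈ H.closedNeighborhood v, u ∈ S.cover ↔ u ∈ S'.cover
  level : ∀ u ∈ H.closedNeighborhood v, S.level u = S'.level u
  deal : ∀ e ∈ H.incident v, S.deal e = S'.deal e
  dual : ∀ e ∈ H.incident v, S.dual e = S'.dual e

theorem AgreeAt.init (hw : ∀ u ∈ H.closedNeighborhood v, w u = w' u)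
    (hdeg : ∀ u ∈ H.closedNeighborhood v, (H.incident u).card = (H'.incident u).card) :
    (MState.init H w).AgreeAt H v (MState.init H' w') := by
  have hdeal : ∀ e ∈ H.incident v, (MState.init H w).deal e = (MState.init H' w').deal e := by
    intro e he
    have hne := H.nonempty_of_mem e (Hypergraph.mem_incident.1 he).1
    rw [init_deal hne, init_deal hne]
    congr 1
    refine Finset.inf'_congr hne rfl fun u hu => ?_
    have hmem := Hypergraph.mem_closedNeighborhood_of_mem he hu
    rw [hw u hmem, hdeg u hmem]
  exact ⟨fun _ _ => Iff.rfl, fun _ _ => rfl, hdeal, hdeal⟩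

theorem AgreeAt.load_eq (h : S.AgreeAt H v S') (hinc : H.incident v = H'.incident v) :
    S.load H v = S'.load H' v := by
  rw [load, load, ← hinc]
  exact Finset.sum_congr rfl h.dual

variable [Fintype V]

theorem AgreeAt.mem_newCover (h : S.AgreeAt H v S') (hinc : H.incident v = H'.incident v)
    (hw : w v = w' v) : v ∈ S.newCover H w β ↔ v ∈ S'.newCover H' w' β := by
  rw [MState.mem_newCover, MState.mem_newCover, h.load_eq hinc,
    h.cover v (H.self_mem_closedNeighborhood v), hw, Hypergraph.uncoveredAt_congr hinc h.cover]

theorem AgreeAt.newLevel_eq (h : S.AgreeAt H v S') (hinc : H.incident v = H'.incident v)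
    (hw : w v = w' v) (hcover : ∀ u ∈ H.closedNeighborhood v,
      u ∈ S.newCover H w β ↔ u ∈ S'.newCover H' w' β) :
    S.newLevel H w (S.newCover H w β) v = S'.newLevel H' w' (S'.newCover H' w' β) v := by
  simp only [newLevel]
  rw [Hypergraph.uncoveredAt_congr hinc hcover, h.load_eq hinc,
    h.level v (H.self_mem_closedNeighborhood v), hw]

theorem AgreeAt.scaledDeal_eq (h : S.AgreeAt H v S')
    (hlevel : ∀ u ∈ H.closedNeighborhood v,
      S.newLevel H w (S.newCover H w β) u = S'.newLevel H' w' (S'.newCover H' w' β) u)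
    (he : e ∈ H.incident v) : S.scaledDeal H w β e = S'.scaledDeal H' w' β e := by
  rw [scaledDeal, scaledDeal, h.deal e he, Finset.sum_congr rfl fun u hu => ?_]
  have hmem := Hypergraph.mem_closedNeighborhood_of_mem he hu
  rw [hlevel u hmem, h.level u hmem]

theorem AgreeAt.raises_iff (h : S.AgreeAt H v S') (hinc : H.incident v = H'.incident v)
    (hw : w v = w' v)
    (hcover : ∀ u ∈ H.closedNeighborhood v, u ∈ S.newCover H w β ↔ u ∈ S'.newCover H' w' β)
    (hlevel : ∀ u ∈ H.closedNeighborhood v,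
      S.newLevel H w (S.newCover H w β) u = S'.newLevel H' w' (S'.newCover H' w' β) u) :
    S.Raises H w β α v ↔ S'.Raises H' w' β α v := by
  rw [Raises, Raises, hlevel v (H.self_mem_closedNeighborhood v), hw,
    ← Hypergraph.uncoveredAt_congr hinc hcover, Finset.sum_congr rfl fun e he =>
      h.scaledDeal_eq hlevel (Hypergraph.uncoveredAt_subset_incident _ _ he)]

theorem AgreeAt.next (h : S.AgreeAt H v S') (hinc : H.incident v = H'.incident v)
    (hcover : ∀ u ∈ H.closedNeighborhood v, u ∈ S.newCover H w β ↔ u ∈ S'.newCover H' w' β)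
    (hlevel : ∀ u ∈ H.closedNeighborhood v,
      S.newLevel H w (S.newCover H w β) u = S'.newLevel H' w' (S'.newCover H' w' β) u)
    (hraise : ∀ u ∈ H.closedNeighborhood v, S.Raises H w β α u ↔ S'.Raises H' w' β α u) :
    (S.next H w β α).AgreeAt H v (S'.next H' w' β α) := by
  have huncovered : ∀ e ∈ H.incident v,
      e ∈ H.uncovered (S.newCover H w β) ↔ e ∈ H'.uncovered (S'.newCover H' w' β) :=
    fun e he => Hypergraph.mem_uncovered_congr hinc hcover he
  have hdeal : ∀ e ∈ H.incident v, (S.next H w β α).deal e = (S'.next H' w' β α).deal e := by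
    intro e he
    have hraises : (∀ u ∈ e, S.Raises H w β α u) ↔ ∀ u ∈ e, S'.Raises H' w' β α u :=
      forall₂_congr fun u hu => hraise u (Hypergraph.mem_closedNeighborhood_of_mem he hu)
    by_cases hu : e ∈ H.uncovered (S.newCover H w β)
    · have hu' := (huncovered e he).1 hu
      by_cases hr : ∀ u ∈ e, S.Raises H w β α u
      · rw [next_deal_of_raise hu hr, next_deal_of_raise hu' (hraises.1 hr),
          h.scaledDeal_eq hlevel he]
      · rw [next_deal_of_stuck hu hr, next_deal_of_stuck hu' (mt hraises.2 hr),
          h.scaledDeal_eq hlevel he]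
    · rw [next_deal_of_covered hu, next_deal_of_covered (mt (huncovered e he).2 hu), h.deal e he]
  refine ⟨hcover, hlevel, hdeal, fun e he => ?_⟩
  by_cases hu : e ∈ H.uncovered (S.newCover H w β)
  · rw [next_dual hu, next_dual ((huncovered e he).1 hu), hdeal e he, h.dual e he]
  · rw [next_dual_of_covered hu, next_dual_of_covered (mt (huncovered e he).2 hu), h.dual e he]

end MState

section Status

variable [Fintype V] {H H' : Hypergraph V} {w w' : V → ℝ} {β α : ℝ} {v : V}

/-- The numbers that the vertices broadcast when they run Algorithm MWHVC: first the degree, and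
then three numbers in each iteration, namely whether the vertex is in the cover, by how much its
level has increased, and whether it raises. -/
def statusNumber (H : Hypergraph V) (w : V → ℝ) (β α : ℝ) : ℕ → V → ℕ
  | 0, v => (H.incident v).card
  | p + 1, v =>
    open Classical in
    let S := MState.after H w β α (1 / 2) (p / 3)
    if p % 3 = 0 then if v ∈ S.newCover H w β then 1 else 0
    else if p % 3 = 1 then S.newLevel H w (S.newCover H w β) v - S.level v
    else if S.Raises H w β α v then 1 else 0

theorem statusNumber_zero : statusNumber H w β α 0 v = (H.incident v).card := rfl

open Classical in
theorem statusNumber_cover (k : ℕ) : statusNumber H w β α (3 * k + 1) v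
    = if v ∈ (MState.after H w β α (1 / 2) k).newCover H w β then 1 else 0 := by
  simp [statusNumber]

theorem statusNumber_level (k : ℕ) : statusNumber H w β α (3 * k + 2) v
    = (MState.after H w β α (1 / 2) k).newLevel H w
        ((MState.after H w β α (1 / 2) k).newCover H w β) v
      - (MState.after H w β α (1 / 2) k).level v := by
  have hdiv : (3 * k + 1) / 3 = k := by lia
  have hmod : (3 * k + 1) % 3 = 1 := by lia
  simp [statusNumber, hdiv, hmod]

open Classical in
theorem statusNumber_raise (k : ℕ) : statusNumber H w β α (3 * k + 3) v
    = if (MState.after H w β α (1 / 2) k).Raises H w β α v then 1 else 0 := by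
  have hdiv : (3 * k + 2) / 3 = k := by lia
  have hmod : (3 * k + 2) % 3 = 2 := by lia
  simp [statusNumber, hdiv, hmod]

theorem exists_eq_three_mul_add {p : ℕ} (hp : p ≠ 0) :
    ∃ k, p = 3 * k + 1 ∨ p = 3 * k + 2 ∨ p = 3 * k + 3 :=
  ⟨(p - 1) / 3, by lia⟩

theorem statusNumber_lt_two (hα : 1 ≤ α) (hw : ∀ v, 0 < w v) {p : ℕ} (hp : p ≠ 0) :
    statusNumber H w β α p v < 2 := by
  obtain ⟨k, rfl | rfl | rfl⟩ := exists_eq_three_mul_add hp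
  · rw [statusNumber_cover]
    split_ifs <;> norm_num
  · rw [statusNumber_level]
    have := MState.newLevel_le (MState.Inv.after (H := H) (β := β) hα hw k)
      ((MState.after H w β α (1 / 2) k).newCover H w β) v
    lia
  · rw [statusNumber_raise]
    split_ifs <;> norm_num

theorem mem_newCover_iff_of_statusNumber_eq {k : ℕ}
    (h : statusNumber H w β α (3 * k + 1) v = statusNumber H' w' β α (3 * k + 1) v) :
    v ∈ (MState.after H w β α (1 / 2) k).newCover H w β
      ↔ v ∈ (MState.after H' w' β α (1 / 2) k).newCover H' w' β := by
  rw [statusNumber_cover, statusNumber_cover] at h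
  split_ifs at h <;> simp_all

theorem raises_iff_of_statusNumber_eq {k : ℕ}
    (h : statusNumber H w β α (3 * k + 3) v = statusNumber H' w' β α (3 * k + 3) v) :
    (MState.after H w β α (1 / 2) k).Raises H w β α v
      ↔ (MState.after H' w' β α (1 / 2) k).Raises H' w' β α v := by
  rw [statusNumber_raise, statusNumber_raise] at h
  split_ifs at h <;> simp_all

theorem newLevel_eq_of_statusNumber_eq (hα : 1 ≤ α) (hw : ∀ v, 0 < w v) (hw' : ∀ v, 0 < w' v)
    {k : ℕ} (h : statusNumber H w β α (3 * k + 2) v = statusNumber H' w' β α (3 * k + 2) v)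
    (hlevel : (MState.after H w β α (1 / 2) k).level v
      = (MState.after H' w' β α (1 / 2) k).level v) :
    (MState.after H w β α (1 / 2) k).newLevel H w
        ((MState.after H w β α (1 / 2) k).newCover H w β) v
      = (MState.after H' w' β α (1 / 2) k).newLevel H' w'
        ((MState.after H' w' β α (1 / 2) k).newCover H' w' β) v := by
  rw [statusNumber_level, statusNumber_level] at h
  have hle := MState.le_newLevel (MState.Inv.after (H := H) (β := β) hα hw k)
    ((MState.after H w β α (1 / 2) k).newCover H w β) v
  have hle' := MState.le_newLevel (MState.Inv.after (H := H') (β := β) hα hw' k)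
    ((MState.after H' w' β α (1 / 2) k).newCover H' w' β) v
  lia

theorem agreeAt_after (hα : 1 ≤ α) (hw : ∀ v, 0 < w v) (hw' : ∀ v, 0 < w' v)
    (hinc : H.incident v = H'.incident v) (hww' : ∀ u ∈ H.closedNeighborhood v, w u = w' u)
    {k : ℕ} (hs : ∀ q < 3 * k + 1, ∀ u ∈ H.closedNeighborhood v,
      statusNumber H w β α q u = statusNumber H' w' β α q u) :
    (MState.after H w β α (1 / 2) k).AgreeAt H v (MState.after H' w' β α (1 / 2) k) := by
  induction k with
  | zero => exact MState.AgreeAt.init hww' (hs 0 one_pos)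
  | succ k ih =>
    have hk := ih fun q hq => hs q (by lia)
    rw [MState.after_succ, MState.after_succ]
    exact hk.next hinc
      (fun u hu => mem_newCover_iff_of_statusNumber_eq (hs _ (by lia) u hu))
      (fun u hu => newLevel_eq_of_statusNumber_eq hα hw hw' (hs _ (by lia) u hu) (hk.level u hu))
      fun u hu => raises_iff_of_statusNumber_eq (hs _ (by lia) u hu)

theorem statusNumber_eq_of_closedNeighborhood (hα : 1 ≤ α) (hw : ∀ v, 0 < w v)
    (hw' : ∀ v, 0 < w' v) (hinc : H.incident v = H'.incident v)
    (hww' : ∀ u ∈ H.closedNeighborhood v, w u = w' u) {p : ℕ}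
    (hs : ∀ q < p, ∀ u ∈ H.closedNeighborhood v,
      statusNumber H w β α q u = statusNumber H' w' β α q u) :
    statusNumber H w β α p v = statusNumber H' w' β α p v := by
  rcases eq_or_ne p 0 with rfl | hp
  · rw [statusNumber_zero, statusNumber_zero, hinc]
  obtain ⟨k, hk⟩ := exists_eq_three_mul_add hp
  have hagree := agreeAt_after (k := k) hα hw hw' hinc hww' fun q hq => hs q (by lia)
  have hwv := hww' v (H.self_mem_closedNeighborhood v)
  classical
  rcases hk with rfl | rfl | rfl
  · rw [statusNumber_cover, statusNumber_cover]
    exact if_congr (hagree.mem_newCover hinc hwv) rfl rfl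
  · rw [statusNumber_level, statusNumber_level,
      hagree.level v (H.self_mem_closedNeighborhood v), hagree.newLevel_eq hinc hwv fun u hu =>
        mem_newCover_iff_of_statusNumber_eq (hs _ (by lia) u hu)]
  · rw [statusNumber_raise, statusNumber_raise]
    refine if_congr (hagree.raises_iff hinc hwv
      (fun u hu => mem_newCover_iff_of_statusNumber_eq (hs _ (by lia) u hu)) fun u hu => ?_) rfl rfl
    exact newLevel_eq_of_statusNumber_eq hα hw hw' (hs _ (by lia) u hu) (hagree.level u hu)

theorem statusNumber_eq_of_incident_eq (hα : 1 ≤ α) (hw : ∀ v, 0 < w v) (hw' : ∀ v, 0 < w' v)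
    (hinc : H.incident v = H'.incident v) (hwv : w v = w' v)
    (hww' : ∀ e ∈ H.incident v, ∀ u ∈ e, w u = w' u) {p : ℕ}
    (hs : ∀ q < p, ∀ e ∈ H.incident v, ∀ u ∈ e,
      statusNumber H w β α q u = statusNumber H' w' β α q u) :
    statusNumber H w β α p v = statusNumber H' w' β α p v := by
  induction p using Nat.strong_induction_on with
  | _ p ih =>
    refine statusNumber_eq_of_closedNeighborhood hα hw hw' hinc ?_ ?_
    · rintro u (rfl | ⟨e, he, hu⟩)
      · exact hwv
      · exact hww' e he u hu
    · rintro q hq u (rfl | ⟨e, he, hu⟩)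
      · exact ih q hq fun r hr => hs r (hr.trans hq)
      · exact hs q hq e he u hu

end Status

end Locality

/-! ## The hypergraph of a covering program -/

/-- The weights `w` with zeros replaced by `1`, since Algorithm MWHVC requires positive weights. -/
def positiveWeight {V : Type} (w : V → ℝ) (v : V) : ℝ :=
  open Classical in if w v = 0 then 1 else w v

theorem positiveWeight_pos {V : Type} {w : V → ℝ} (hw : ∀ v, 0 ≤ w v) (v : V) :
    0 < positiveWeight w v := by
  unfold positiveWeight
  split_ifs with h
  · exact one_pos
  · exact lt_of_le_of_ne (hw v) (Ne.symm h)

theorem IsZeroOneSolution.nonneg {m n : ℕ} {A : Matrix (Fin m) (Fin n) ℝ} {b : Fin m → ℝ}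
    {y : Fin n → ℝ} (hy : IsZeroOneSolution A b y) (j : Fin n) : 0 ≤ y j := by
  rcases hy.1 j with h | h <;> rw [h]
  exact zero_le_one

theorem IsZeroOneSolution.le_one {m n : ℕ} {A : Matrix (Fin m) (Fin n) ℝ} {b : Fin m → ℝ}
    {y : Fin n → ℝ} (hy : IsZeroOneSolution A b y) (j : Fin n) : y j ≤ 1 := by
  rcases hy.1 j with h | h <;> rw [h]
  exact zero_le_one

namespace Program

variable {m n : ℕ} {P P' : Program m n} {i : Fin m} {j : Fin n}

theorem mulVec_eq_sum_row (P : Program m n) (x : Fin n → ℝ) (i : Fin m) :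
    P.matrix.mulVec x i = ∑ j ∈ P.row i, P.matrix i j * x j := by
  rw [Matrix.mulVec, dotProduct, row, Finset.sum_filter_of_ne]
  exact fun j _ h => left_ne_zero_of_mul h

theorem rhs_le_sum_sdiff {y : Fin n → ℝ} {e : Finset (Fin n)} (hA : ∀ i j, 0 ≤ P.matrix i j)
    (hy : IsZeroOneSolution P.matrix P.rhs y) (he : ∀ j ∈ e, y j = 0) (i : Fin m) :
    P.rhs i ≤ ∑ j ∈ P.row i \ e, P.matrix i j :=
  calc P.rhs i ≤ ∑ j ∈ P.row i, P.matrix i j * y j := (hy.2 i).trans_eq (P.mulVec_eq_sum_row y i)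
    _ = ∑ j ∈ P.row i \ e, P.matrix i j * y j := by
        refine (Finset.sum_subset Finset.sdiff_subset fun j hj hje => ?_).symm
        rw [he j (by simpa [hj] using hje), mul_zero]
    _ ≤ ∑ j ∈ P.row i \ e, P.matrix i j :=
        Finset.sum_le_sum fun j _ => mul_le_of_le_one_right (hA i j) (hy.le_one j)

open Classical in
/-- The hypergraph whose covers, together with the variables of weight zero, are the zero-one
solutions of `P`: a set of variables of positive weight of some constraint is a hyperedge if the
constraint is violated when all of them are zero. -/
def coverHypergraph (P : Program m n) : Hypergraph (Fin n) where
  edges := Finset.univ.filter fun e => e.Nonempty ∧ ∃ i, e ⊆ P.row i ∧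
    (∀ j ∈ e, P.weight j ≠ 0) ∧ ∑ j ∈ P.row i \ e, P.matrix i j < P.rhs i
  nonempty_of_mem _ he := (Finset.mem_filter.1 he).2.1

theorem mem_coverHypergraph {e : Finset (Fin n)} : e ∈ P.coverHypergraph.edges ↔
    e.Nonempty ∧ ∃ i, e ⊆ P.row i ∧ (∀ j ∈ e, P.weight j ≠ 0) ∧
      ∑ j ∈ P.row i \ e, P.matrix i j < P.rhs i := by
  simp [coverHypergraph]

theorem exists_row_of_mem_coverHypergraph {e : Finset (Fin n)}
    (he : e ∈ P.coverHypergraph.edges) : ∃ i, e ⊆ P.row i :=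
  let ⟨_, i, hi, _⟩ := mem_coverHypergraph.1 he
  ⟨i, hi⟩

theorem coverHypergraph_rankLE (P : Program m n) :
    P.coverHypergraph.RankLE (rowSupport P.matrix) := fun _ he =>
  let ⟨i, hi⟩ := exists_row_of_mem_coverHypergraph he
  (Finset.card_le_card hi).trans (P.card_row_le i)

theorem card_column_le (P : Program m n) (j : Fin n) :
    (Finset.univ.filter fun i => P.matrix i j ≠ 0).card ≤ colSupport P.matrix :=
  Finset.le_sup (f := fun j => (Finset.univ.filter fun i => P.matrix i j ≠ 0).card)
    (Finset.mem_univ j)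

theorem coverHypergraph_degreeLE (P : Program m n) :
    P.coverHypergraph.DegreeLE (2 ^ rowSupport P.matrix * colSupport P.matrix) := by
  intro j
  have hsub : P.coverHypergraph.incident j
      ⊆ (Finset.univ.filter fun i => P.matrix i j ≠ 0).biUnion fun i => (P.row i).powerset := by
    intro e he
    obtain ⟨he, hj⟩ := Hypergraph.mem_incident.1 he
    obtain ⟨i, hi⟩ := exists_row_of_mem_coverHypergraph he
    exact Finset.mem_biUnion.2 ⟨i, by simpa using hi hj, Finset.mem_powerset.2 hi⟩
  calc (P.coverHypergraph.incident j).card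
      ≤ (Finset.univ.filter fun i => P.matrix i j ≠ 0).card * 2 ^ rowSupport P.matrix := by
        refine (Finset.card_le_card hsub).trans
          (Finset.card_biUnion_le_card_mul _ _ _ fun i _ => ?_)
        rw [Finset.card_powerset]
        exact Nat.pow_le_pow_right two_pos (P.card_row_le i)
    _ ≤ 2 ^ rowSupport P.matrix * colSupport P.matrix := by
        rw [mul_comm]
        exact Nat.mul_le_mul_left _ (P.card_column_le j)

open Classical in
/-- The zero-one vector of a set `C` of variables and all variables of weight zero. -/
def coverVector (P : Program m n) (C : Finset (Fin n)) (j : Fin n) : ℝ :=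
  if P.weight j = 0 ∨ j ∈ C then 1 else 0

theorem isZeroOneSolution_coverVector {C : Finset (Fin n)} (hA : ∀ i j, 0 ≤ P.matrix i j)
    (hfeasible : ∃ y, IsZeroOneSolution P.matrix P.rhs y)
    (hC : P.coverHypergraph.uncovered C = ∅) :
    IsZeroOneSolution P.matrix P.rhs (P.coverVector C) := by
  classical
  refine ⟨fun j => by unfold coverVector; split_ifs <;> simp, fun i => ?_⟩
  obtain ⟨y, hy⟩ := hfeasible
  set e := (P.row i).filter fun j => ¬(P.weight j = 0 ∨ j ∈ C) with he
  have hsum : P.matrix.mulVec (P.coverVector C) i = ∑ j ∈ P.row i \ e, P.matrix i j := by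
    rw [mulVec_eq_sum_row, he, Finset.filter_not, Finset.sdiff_sdiff_eq_self
      (Finset.filter_subset _ _), Finset.sum_filter]
    exact Finset.sum_congr rfl fun j _ => mul_ite_zero _ _ _ |>.trans (by rw [mul_one])
  rw [hsum]
  by_contra! hviolated
  have hne : e.Nonempty := by
    rw [Finset.nonempty_iff_ne_empty]
    intro hempty
    rw [hempty] at hviolated
    exact hviolated.not_ge (rhs_le_sum_sdiff hA hy (by simp) i)
  have hmem : ∀ j ∈ e, P.weight j ≠ 0 ∧ j ∉ C := fun j hj => not_or.1 (Finset.mem_filter.1 hj).2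
  have huncovered : e ∈ P.coverHypergraph.uncovered C :=
    Hypergraph.mem_uncovered.2 ⟨mem_coverHypergraph.2 ⟨hne, i, Finset.filter_subset _ _,
      fun j hj => (hmem j hj).1, hviolated⟩, Finset.disjoint_left.2 fun j hj => (hmem j hj).2⟩
  exact Finset.notMem_empty e (hC ▸ huncovered)

theorem weight_coverVector_le (P : Program m n) (C : Finset (Fin n)) :
    P.weight ⬝ᵥ P.coverVector C ≤ ∑ j ∈ C, positiveWeight P.weight j := by
  classical
  rw [dotProduct, ← Finset.sum_subset (Finset.subset_univ C) fun j _ hj => ?_]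
  · refine Finset.sum_le_sum fun j hj => ?_
    rw [coverVector, if_pos (Or.inr hj), mul_one, positiveWeight]
    split_ifs with hzero
    · exact hzero.trans_le zero_le_one
    · exact le_rfl
  · by_cases hzero : P.weight j = 0 <;> simp [coverVector, hzero, hj]

open Classical in
/-- The variables of nonzero weight that are chosen by `y`. -/
def weightedSupport (P : Program m n) (y : Fin n → ℝ) : Finset (Fin n) :=
  Finset.univ.filter fun j => y j = 1 ∧ P.weight j ≠ 0

theorem exists_mem_weightedSupport {y : Fin n → ℝ} (hA : ∀ i j, 0 ≤ P.matrix i j)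
    (hy : IsZeroOneSolution P.matrix P.rhs y) :
    ∀ e ∈ P.coverHypergraph.edges, ∃ j ∈ e, j ∈ P.weightedSupport y := by
  intro e he
  obtain ⟨_, i, _, hweight, hviolated⟩ := mem_coverHypergraph.1 he
  by_contra! hdisjoint
  refine hviolated.not_ge (rhs_le_sum_sdiff hA hy (fun j hj => ?_) i)
  refine (hy.1 j).resolve_right fun hone => hdisjoint j hj ?_
  exact Finset.mem_filter.2 ⟨Finset.mem_univ _, hone, hweight j hj⟩

theorem sum_weightedSupport_le {y : Fin n → ℝ} (hw : ∀ j, 0 ≤ P.weight j) (hy : ∀ j, 0 ≤ y j) :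
    ∑ j ∈ P.weightedSupport y, positiveWeight P.weight j ≤ P.weight ⬝ᵥ y := by
  rw [dotProduct, weightedSupport, Finset.sum_filter]
  refine Finset.sum_le_sum fun j _ => ?_
  split_ifs with hj
  · rw [positiveWeight, if_neg hj.2, hj.1, mul_one]
  · exact mul_nonneg (hw j) (hy j)

theorem isApproxSolution_coverVector {C : Finset (Fin n)} {ρ : ℝ}
    (hP : IsCovering P.matrix P.rhs P.weight)
    (hfeasible : ∃ y, IsZeroOneSolution P.matrix P.rhs y)
    (hC : P.coverHypergraph.uncovered C = ∅) (hρ : 0 ≤ ρ)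
    (hratio : ∀ Y : Finset (Fin n), (∀ e ∈ P.coverHypergraph.edges, ∃ j ∈ e, j ∈ Y) →
      ∑ j ∈ C, positiveWeight P.weight j ≤ ρ * ∑ j ∈ Y, positiveWeight P.weight j) :
    IsApproxSolution P.matrix P.rhs P.weight ρ (P.coverVector C) := by
  refine ⟨isZeroOneSolution_coverVector hP.1 hfeasible hC, fun y hy => ?_⟩
  calc P.weight ⬝ᵥ P.coverVector C
      ≤ ∑ j ∈ C, positiveWeight P.weight j := P.weight_coverVector_le C
    _ ≤ ρ * ∑ j ∈ P.weightedSupport y, positiveWeight P.weight j :=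
        hratio _ (exists_mem_weightedSupport hP.1 hy)
    _ ≤ ρ * (P.weight ⬝ᵥ y) :=
        mul_le_mul_of_nonneg_left (sum_weightedSupport_le hP.2.2 hy.nonneg) hρ

theorem SameAround.symm (h : P.SameAround P' j) : P'.SameAround P j where
  weight := h.weight.symm
  column i := (h.column i).symm
  rhs i hi := (h.rhs i (h.column i ▸ hi)).symm
  row i hi k := (h.row i (h.column i ▸ hi) k).symm
  row_weight i hi k hk := by
    have hi' : P.matrix i j ≠ 0 := h.column i ▸ hi
    exact (h.row_weight i hi' k (h.row i hi' k ▸ hk)).symm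

theorem SameAround.incident_subset (h : P.SameAround P' j) :
    P.coverHypergraph.incident j ⊆ P'.coverHypergraph.incident j := by
  intro e he
  obtain ⟨he, hj⟩ := Hypergraph.mem_incident.1 he
  obtain ⟨hne, i, hi, hweight, hviolated⟩ := mem_coverHypergraph.1 he
  have hij : P.matrix i j ≠ 0 := mem_row.1 (hi hj)
  have hrow : P'.row i = P.row i := by ext k; simp [h.row i hij]
  refine Hypergraph.mem_incident.2
    ⟨mem_coverHypergraph.2 ⟨hne, i, hrow ▸ hi, fun k hk => ?_, ?_⟩, hj⟩
  · rw [← h.row_weight i hij k (mem_row.1 (hi hk))]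
    exact hweight k hk
  · rw [hrow, ← h.rhs i hij, ← Finset.sum_congr rfl fun k _ => h.row i hij k]
    exact hviolated

theorem SameAround.incident_eq (h : P.SameAround P' j) :
    P.coverHypergraph.incident j = P'.coverHypergraph.incident j :=
  h.incident_subset.antisymm h.symm.incident_subset

theorem SameAround.statusNumber_eq {β α : ℝ} (h : P.SameAround P' j) (hα : 1 ≤ α)
    (hw : ∀ k, 0 ≤ P.weight k) (hw' : ∀ k, 0 ≤ P'.weight k) {p : ℕ}
    (hs : ∀ q < p, P.AgreeAround j
      (statusNumber P.coverHypergraph (positiveWeight P.weight) β α q)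
      (statusNumber P'.coverHypergraph (positiveWeight P'.weight) β α q)) :
    statusNumber P.coverHypergraph (positiveWeight P.weight) β α p j
      = statusNumber P'.coverHypergraph (positiveWeight P'.weight) β α p j := by
  have hconstraint : ∀ e ∈ P.coverHypergraph.incident j, ∀ u ∈ e,
      ∃ i, P.matrix i j ≠ 0 ∧ P.matrix i u ≠ 0 := by
    intro e he u hu
    obtain ⟨he, hj⟩ := Hypergraph.mem_incident.1 he
    obtain ⟨i, hi⟩ := exists_row_of_mem_coverHypergraph he
    exact ⟨i, mem_row.1 (hi hj), mem_row.1 (hi hu)⟩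
  refine statusNumber_eq_of_incident_eq hα (positiveWeight_pos hw) (positiveWeight_pos hw')
    h.incident_eq ?_ ?_ ?_
  · rw [positiveWeight, positiveWeight, h.weight]
  · intro e he u hu
    obtain ⟨i, hij, hiu⟩ := hconstraint e he u hu
    rw [positiveWeight, positiveWeight, h.row_weight i hij u hiu]
  · intro q hq e he u hu
    obtain ⟨i, hij, hiu⟩ := hconstraint e he u hu
    exact hs q hq i hij u hiu

open Classical in
/-- The zero-one vector of all variables of the constraints with a positive right-hand side. -/
def demandVector (P : Program m n) (j : Fin n) : ℝ :=
  if ∃ i, P.matrix i j ≠ 0 ∧ 0 < P.rhs i then 1 else 0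

theorem SameAround.demandVector_eq (h : P.SameAround P' j) :
    P.demandVector j = P'.demandVector j := by
  classical
  refine if_congr (exists_congr fun i => ?_) rfl rfl
  rw [← h.column i]
  exact and_congr_right fun hij => by rw [h.rhs i hij]

theorem isZeroOneSolution_demandVector (hA : ∀ i j, 0 ≤ P.matrix i j)
    (hfeasible : ∃ y, IsZeroOneSolution P.matrix P.rhs y) :
    IsZeroOneSolution P.matrix P.rhs P.demandVector := by
  have hzeroOne : ∀ j, P.demandVector j = 0 ∨ P.demandVector j = 1 := fun j => by
    unfold demandVector
    split_ifs <;> simp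
  refine ⟨hzeroOne, fun i => ?_⟩
  obtain ⟨y, hy⟩ := hfeasible
  rw [mulVec_eq_sum_row]
  rcases le_or_gt (P.rhs i) 0 with hb | hb
  · refine hb.trans (Finset.sum_nonneg fun j _ => mul_nonneg (hA i j) ?_)
    rcases hzeroOne j with h | h <;> rw [h]
    exact zero_le_one
  · calc P.rhs i ≤ ∑ j ∈ P.row i \ ∅, P.matrix i j := rhs_le_sum_sdiff hA hy (by simp) i
      _ = ∑ j ∈ P.row i, P.matrix i j * P.demandVector j := by
        rw [Finset.sdiff_empty]
        refine Finset.sum_congr rfl fun j hj => ?_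
        rw [demandVector, if_pos ⟨i, mem_row.1 hj, hb⟩, mul_one]

theorem mulVec_eq_of_rowSupport_le_one (hf : rowSupport P.matrix ≤ 1) (hij : P.matrix i j ≠ 0)
    (x : Fin n → ℝ) : P.matrix.mulVec x i = P.matrix i j * x j := by
  have hj : j ∈ P.row i := mem_row.2 hij
  have hsingleton : P.row i = {j} := Finset.eq_singleton_iff_unique_mem.2
    ⟨hj, fun k hk => Finset.card_le_one.1 ((P.card_row_le i).trans hf) k hk j hj⟩
  rw [mulVec_eq_sum_row, hsingleton, Finset.sum_singleton]

theorem one_le_colSupport (hij : P.matrix i j ≠ 0) : 1 ≤ colSupport P.matrix :=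
  (Finset.card_pos.2 ⟨i, by simpa using hij⟩).trans_le (P.card_column_le j)

theorem one_le_rowSupport (hij : P.matrix i j ≠ 0) : 1 ≤ rowSupport P.matrix :=
  (Finset.card_pos.2 ⟨j, mem_row.2 hij⟩).trans_le (P.card_row_le i)

theorem demandVector_le {y : Fin n → ℝ} (hf : rowSupport P.matrix ≤ 1)
    (hy : IsZeroOneSolution P.matrix P.rhs y) (j : Fin n) :
    P.demandVector j ≤ rowSupport P.matrix * y j := by
  unfold demandVector
  split_ifs with h
  · obtain ⟨i, hij, hb⟩ := h
    have hone : y j = 1 := by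
      refine (hy.1 j).resolve_left fun hzero => ?_
      have hle := hy.2 i
      rw [mulVec_eq_of_rowSupport_le_one hf hij, hzero, mul_zero] at hle
      exact hb.not_ge hle
    rw [hone, mul_one]
    exact_mod_cast one_le_rowSupport hij
  · exact mul_nonneg (Nat.cast_nonneg _) (hy.nonneg j)

theorem isApproxSolution_demandVector {ρ : ℝ} (hP : IsCovering P.matrix P.rhs P.weight)
    (hfeasible : ∃ y, IsZeroOneSolution P.matrix P.rhs y) (hf : rowSupport P.matrix ≤ 1)
    (hρ : rowSupport P.matrix ≤ ρ) :
    IsApproxSolution P.matrix P.rhs P.weight ρ P.demandVector := by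
  refine ⟨isZeroOneSolution_demandVector hP.1 hfeasible, fun y hy => ?_⟩
  calc P.weight ⬝ᵥ P.demandVector
      ≤ ∑ j, P.weight j * (ρ * y j) := Finset.sum_le_sum fun j _ =>
        mul_le_mul_of_nonneg_left ((demandVector_le hf hy j).trans
          (mul_le_mul_of_nonneg_right hρ (hy.nonneg j))) (hP.2.2 j)
    _ = ρ * (P.weight ⬝ᵥ y) := by
        rw [dotProduct, Finset.mul_sum]
        exact Finset.sum_congr rfl fun j _ => by ring

end Program

/-! ## The distributed algorithm -/

/-- A feasible zero-one covering program with `f(A) = f` and `Δ(A) = Δ` whose numbers have codes of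
at most `K` bits in the number format `dec`. -/
structure Program.IsInstance {m n : ℕ} (dec : List Bool → ℝ) (K f Δ : ℕ) (P : Program m n) :
    Prop where
  isCovering : IsCovering P.matrix P.rhs P.weight
  rowSupport_eq : rowSupport P.matrix = f
  colSupport_eq : colSupport P.matrix = Δ
  hasCodes : InputHasCodes dec K P.matrix P.rhs P.weight
  feasible : ∃ y, IsZeroOneSolution P.matrix P.rhs y

/-- The algorithm `alg`, run on the network of `P` with messages of at most `bits` bits, computes a
`ρ`-approximate solution of `P` within `R` rounds. -/
structure DistAlgorithm.Solves {m n : ℕ}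
    (alg : DistAlgorithm (Fin n ⊕ Fin m) (LocalInput m) ℝ) (P : Program m n) (bits R : ℕ) (ρ : ℝ) :
    Prop where
  messagesLE : alg.MessagesLE (network P.matrix) (localInput P.matrix P.rhs P.weight) bits
  haltsWithin : alg.HaltsWithin (network P.matrix) (localInput P.matrix P.rhs P.weight) R
  isApproxSolution : IsApproxSolution P.matrix P.rhs P.weight ρ fun j =>
    alg.output (alg.config (network P.matrix) (localInput P.matrix P.rhs P.weight) R (Sum.inl j))

theorem DistAlgorithm.Computes.solves {m n : ℕ}
    {alg : DistAlgorithm (Fin n ⊕ Fin m) (LocalInput m) ℝ} {P : Program m n} {bits R : ℕ} {ρ : ℝ}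
    {x : Fin n → ℝ} {z : Fin m → ℝ}
    (h : alg.Computes (network P.matrix) (localInput P.matrix P.rhs P.weight) bits R (Sum.elim x z))
    (hx : IsApproxSolution P.matrix P.rhs P.weight ρ x) : alg.Solves P bits R ρ :=
  ⟨h.messagesLE, h.haltsWithin, by simpa only [h.output_eq, Sum.elim_inl] using hx⟩

section Schedule

variable {f s : ℕ}

/-- The number of rounds in which `f` bits are sent in messages of about `s` bits. -/
def slowdown (f s : ℕ) : ℕ := f / s + 1

theorem lt_mul_slowdown (hs : 0 < s) : f < s * slowdown f s := Nat.lt_mul_div_succ f hs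

theorem slowdown_pos : 0 < slowdown f s := Nat.succ_pos _

/-- The number of rounds of the step `t` of the broadcast: only the first two reports and answers,
which contain the input and the degrees, are long. -/
def stepRounds (f s t : ℕ) : ℕ := if t < 4 then slowdown f s * (1 + f) else slowdown f s

theorem stepRounds_pos (t : ℕ) : 0 < stepRounds f s t := by
  have := slowdown_pos (f := f) (s := s)
  unfold stepRounds
  split_ifs <;> positivity

theorem stepRounds_two_mul_add_one (p : ℕ) :
    stepRounds f s (2 * p + 1) = stepRounds f s (2 * p) :=
  if_congr (by lia) rfl rfl

theorem startRound_stepRounds_two :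
    startRound (stepRounds f s) 2 = slowdown f s * (2 * (1 + f)) := by
  simp only [startRound, Finset.sum_range_succ, Finset.sum_range_zero, stepRounds, zero_add,
    Nat.ofNat_pos, Nat.one_lt_ofNat, if_true]
  ring

theorem startRound_stepRounds_four_add (k : ℕ) :
    startRound (stepRounds f s) (4 + k) = slowdown f s * (4 * (1 + f) + k) := by
  induction k with
  | zero => simp [startRound, Finset.sum_range_succ, stepRounds]; ring
  | succ k ih =>
    rw [← add_assoc, startRound_succ, ih, stepRounds, if_neg (by lia)]
    ring

end Schedule

/-- The format of the messages with which Algorithm MWHVC is simulated: the values announced are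
the degrees first, and single bits afterwards. -/
def statusFormat (dec : List Bool → ℝ) (κ s f : ℕ) : MessageFormat where
  dec := dec
  numberBits := κ * s
  idBits := s
  valueBits p := if p = 0 then f + s else 1

section Format

variable {dec : List Bool → ℝ} {κ s f : ℕ}

theorem reportLength_statusFormat_pos (hs : 0 < s) (p : ℕ) :
    0 < (statusFormat dec κ s f).reportLength p := by
  rcases p with _ | _ | p <;> simp [MessageFormat.reportLength, statusFormat, hs]

theorem reportLength_statusFormat_le (hs : 0 < s) {p : ℕ} (hp : p < 2) :
    (statusFormat dec κ s f).reportLength p ≤ (4 * κ + 2) * s * slowdown f s := by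
  have hslow := lt_mul_slowdown (f := f) hs
  have hone : (4 * κ + 2) * s ≤ (4 * κ + 2) * s * slowdown f s :=
    Nat.le_mul_of_pos_right _ slowdown_pos
  interval_cases p <;> simp only [MessageFormat.reportLength, statusFormat, if_true] <;> nlinarith

theorem two_mul_add_reportLength_statusFormat_le (hs : 0 < s) (p : ℕ) :
    2 * (κ * s) + (1 + f) * (statusFormat dec κ s f).reportLength p
      ≤ (6 * κ + 2) * s * stepRounds f s (2 * p) := by
  have hone := slowdown_pos (f := f) (s := s)
  rcases Nat.lt_or_ge p 2 with hp | hp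
  · rw [stepRounds, if_pos (by lia)]
    calc 2 * (κ * s) + (1 + f) * (statusFormat dec κ s f).reportLength p
        ≤ 2 * (κ * s) * (slowdown f s * (1 + f))
          + (1 + f) * ((4 * κ + 2) * s * slowdown f s) :=
          add_le_add (Nat.le_mul_of_pos_right _ (Nat.mul_pos slowdown_pos (by lia)))
            (Nat.mul_le_mul_left _ (reportLength_statusFormat_le hs hp))
      _ = (6 * κ + 2) * s * (slowdown f s * (1 + f)) := by ring
  · have hlength : (statusFormat dec κ s f).reportLength p = 1 := by
      obtain ⟨q, rfl⟩ := Nat.exists_eq_add_of_le' hp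
      simp [MessageFormat.reportLength, statusFormat]
    rw [stepRounds, if_neg (by lia), hlength]
    calc 2 * (κ * s) + (1 + f) * 1
        ≤ 6 * (κ * s) * slowdown f s + 2 * (s * slowdown f s) := by
          have hslow := lt_mul_slowdown (f := f) hs
          have hcode := Nat.le_mul_of_pos_right (κ * s) hone
          lia
      _ = (6 * κ + 2) * s * slowdown f s := by ring

variable {m n : ℕ}

theorem exists_computes_of_fits_statusFormat {S : Set (Program m n)}
    {x : Program m n → ℕ → Fin n → ℕ} {out : Program m n → Fin n → ℝ} {T : ℕ} (hs : 0 < s)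
    (hn : n ≤ 2 ^ s) (hS : ∀ P ∈ S, (statusFormat dec κ s f).Fits P (x P))
    (hf : ∀ P ∈ S, rowSupport P.matrix ≤ f)
    (hx : ∀ P ∈ S, ∀ P' ∈ S, ∀ j, ∀ p < T, P.SameAround P' j →
      (∀ q < p, P.AgreeAround j (x P q) (x P' q)) → x P p j = x P' p j)
    (hout : ∀ P ∈ S, ∀ P' ∈ S, ∀ j, P.SameAround P' j →
      (∀ q < T, P.AgreeAround j (x P q) (x P' q)) → out P j = out P' j) :
    ∃ alg : DistAlgorithm (Fin n ⊕ Fin m) (LocalInput m) ℝ, ∀ P ∈ S,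
      alg.Computes (network P.matrix) (localInput P.matrix P.rhs P.weight) ((6 * κ + 2) * s)
        (startRound (stepRounds f s) (2 * (T + 1))) (Sum.elim (out P) fun _ => 0) := by
  refine MessageFormat.exists_computes_of_broadcast (F := statusFormat dec κ s f) hn
    (reportLength_statusFormat_pos hs) hS hf stepRounds_pos (fun p _ => ?_) (fun p _ => ?_) hx hout
  · have := two_mul_add_reportLength_statusFormat_le (dec := dec) (κ := κ) (f := f) hs p
    lia
  · rw [stepRounds_two_mul_add_one]
    refine le_trans ?_ (two_mul_add_reportLength_statusFormat_le (dec := dec) hs p)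
    exact Nat.add_le_add_left (Nat.mul_le_mul_right _ (Nat.le_add_left f 1)) _

theorem exists_solves_of_rowSupport_le_one {Δ : ℕ} {ρ : ℝ} (hs : 0 < s) (hn : n ≤ 2 ^ s)
    (hf : f ≤ 1) (hρ : f ≤ ρ) :
    ∃ alg : DistAlgorithm (Fin n ⊕ Fin m) (LocalInput m) ℝ,
      ∀ P : Program m n, P.IsInstance dec (κ * s) f Δ →
        alg.Solves P ((6 * κ + 2) * s) (slowdown f s * (2 * (1 + f))) ρ := by
  obtain ⟨alg, halg⟩ := exists_computes_of_fits_statusFormat (m := m) (dec := dec) (κ := κ) (f := f)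
    (S := {P | P.IsInstance dec (κ * s) f Δ}) (x := fun _ _ _ => 0)
    (out := Program.demandVector) (T := 0) hs hn
    (fun P hP => ⟨hP.hasCodes, fun _ _ => by positivity⟩)
    (fun P hP => hP.rowSupport_eq.le) (fun _ _ _ _ _ _ _ _ _ => rfl)
    fun P _ P' _ j h _ => h.demandVector_eq
  refine ⟨alg, fun P hP => startRound_stepRounds_two (f := f) ▸ (halg P hP).solves ?_⟩
  have hrow := hP.rowSupport_eq
  exact P.isApproxSolution_demandVector hP.isCovering hP.feasible (by rwa [hrow]) (by rwa [hrow])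

theorem colSupport_le (A : Matrix (Fin m) (Fin n) ℝ) : colSupport A ≤ m :=
  Finset.sup_le fun _ _ => (Finset.card_filter_le _ _).trans_eq (Finset.card_fin m)

namespace Program

variable {Δ : ℕ} {α β : ℝ} {P P' : Program m n}

theorem IsInstance.rankLE {K : ℕ} (hP : P.IsInstance dec K f Δ) : P.coverHypergraph.RankLE f :=
  hP.rowSupport_eq ▸ P.coverHypergraph_rankLE

theorem IsInstance.degreeLE {K : ℕ} (hP : P.IsInstance dec K f Δ) :
    P.coverHypergraph.DegreeLE (2 ^ f * Δ) :=
  hP.rowSupport_eq ▸ hP.colSupport_eq ▸ P.coverHypergraph_degreeLE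

theorem IsInstance.positiveWeight_pos {K : ℕ} (hP : P.IsInstance dec K f Δ) (j : Fin n) :
    0 < positiveWeight P.weight j :=
  DistCover.positiveWeight_pos hP.isCovering.2.2 j

theorem IsInstance.fits_statusNumber (hP : P.IsInstance dec (κ * s) f Δ) (hm : m < 2 ^ s)
    (hα : 1 ≤ α) : (statusFormat dec κ s f).Fits P
      (statusNumber P.coverHypergraph (positiveWeight P.weight) β α) := by
  refine ⟨hP.hasCodes, fun p j => ?_⟩
  rcases eq_or_ne p 0 with rfl | hp
  · have hΔ : Δ < 2 ^ s := by
      rw [← hP.colSupport_eq]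
      exact (colSupport_le _).trans_lt hm
    calc (P.coverHypergraph.incident j).card ≤ 2 ^ f * Δ := hP.degreeLE j
      _ < 2 ^ f * 2 ^ s := Nat.mul_lt_mul_of_pos_left hΔ (by positivity)
      _ = 2 ^ (f + s) := (pow_add 2 f s).symm
  · simpa [statusFormat, hp] using statusNumber_lt_two hα hP.positiveWeight_pos hp

theorem SameAround.coverVector_after_eq {j : Fin n} (h : P.SameAround P' j) (hα : 1 ≤ α)
    (hw : ∀ k, 0 ≤ P.weight k) (hw' : ∀ k, 0 ≤ P'.weight k) {N : ℕ}
    (hs : ∀ q < 3 * N + 1, P.AgreeAround j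
      (statusNumber P.coverHypergraph (positiveWeight P.weight) β α q)
      (statusNumber P'.coverHypergraph (positiveWeight P'.weight) β α q)) :
    P.coverVector (MState.after P.coverHypergraph (positiveWeight P.weight) β α (1 / 2) N).cover j
      = P'.coverVector
        (MState.after P'.coverHypergraph (positiveWeight P'.weight) β α (1 / 2) N).cover j := by
  have hcover :
      j ∈ (MState.after P.coverHypergraph (positiveWeight P.weight) β α (1 / 2) N).cover
        ↔ j ∈ (MState.after P'.coverHypergraph (positiveWeight P'.weight) β α (1 / 2) N).cover := by
    cases N with
    | zero => simp [MState.after, MState.init]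
    | succ N =>
      rw [MState.after_succ, MState.after_succ]
      exact mem_newCover_iff_of_statusNumber_eq
        (h.statusNumber_eq hα hw hw' fun q hq => hs q (by lia))
  exact if_congr (by rw [h.weight, hcover]) rfl rfl

end Program

theorem exists_solves_of_iterations {Δ N : ℕ} {α ε : ℝ} (hs : 0 < s) (hn : n ≤ 2 ^ s)
    (hm : m < 2 ^ s) (hf : 0 < f) (hε : 0 < ε) (hα : 1 ≤ α)
    (hN : ∀ P : Program m n, P.IsInstance dec (κ * s) f Δ → P.coverHypergraph.uncovered
      (MState.after P.coverHypergraph (positiveWeight P.weight) (ε / (f + ε)) α (1 / 2) N).cover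
        = ∅) :
    ∃ alg : DistAlgorithm (Fin n ⊕ Fin m) (LocalInput m) ℝ,
      ∀ P : Program m n, P.IsInstance dec (κ * s) f Δ →
        alg.Solves P ((6 * κ + 2) * s) (slowdown f s * (4 * (1 + f) + 6 * N)) (f + ε) := by
  have hrounds : startRound (stepRounds f s) (2 * (3 * N + 1 + 1))
      = slowdown f s * (4 * (1 + f) + 6 * N) := by
    rw [← startRound_stepRounds_four_add]
    congr 1
    ring
  obtain ⟨alg, halg⟩ := exists_computes_of_fits_statusFormat
    (S := {P | P.IsInstance dec (κ * s) f Δ}) (T := 3 * N + 1)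
    (x := fun P => statusNumber P.coverHypergraph (positiveWeight P.weight) (ε / (f + ε)) α)
    (out := fun P => P.coverVector (MState.after P.coverHypergraph (positiveWeight P.weight)
      (ε / (f + ε)) α (1 / 2) N).cover)
    hs hn (fun P hP => hP.fits_statusNumber hm hα) (fun P hP => hP.rowSupport_eq.le)
    (fun P hP P' hP' j p _ h hq => h.statusNumber_eq hα hP.isCovering.2.2 hP'.isCovering.2.2 hq)
    fun P hP P' hP' j h hq => h.coverVector_after_eq hα hP.isCovering.2.2 hP'.isCovering.2.2 hq
  refine ⟨alg, fun P hP => hrounds ▸ (halg P hP).solves ?_⟩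
  exact P.isApproxSolution_coverVector hP.isCovering hP.feasible (hN P hP) (by positivity)
    fun Y hY => MState.sum_cover_le hε hP.rankLE hf hα hP.positiveWeight_pos N hY

end Format

/-! ## The number of rounds -/

theorem uncovered_eq_empty_of_mwhvcRounds_le {γ ε : ℝ} {n f D T : ℕ} {H : Hypergraph (Fin n)}
    {w : Fin n → ℝ} (hf : H.RankLE f) (hD : H.DegreeLE D) (hw : ∀ v, 0 < w v)
    (hT : mwhvcRounds γ f D ε ≤ T) : H.uncovered (MState.after H w (ε / (f + ε))
      (multiplier γ f D ε) (1 / 2) ((T - 2) / 4)).cover = ∅ := by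
  by_contra! hne
  have hle : 2 + 4 * ((T - 2) / 4 + 1) ≤ T := by
    exact_mod_cast (le_mwhvcRounds_of_uncovered_nonempty hf hD hw hne).trans hT
  lia

theorem bitSize_pos (N : ℕ) : 0 < bitSize N := Nat.succ_pos _

theorem lt_two_pow_bitSize (N : ℕ) : N < 2 ^ bitSize N := Nat.lt_pow_succ_log_self one_lt_two N

theorem log_le_bitSize {n N : ℕ} (h : n ≤ N) : Real.log n ≤ bitSize N := by
  rcases n.eq_zero_or_pos with rfl | hn
  · simp
  calc Real.log n ≤ Real.log (2 ^ bitSize N) :=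
        Real.log_le_log (by positivity) (by exact_mod_cast h.trans (lt_two_pow_bitSize N).le)
    _ = bitSize N * Real.log 2 := Real.log_pow _ _
    _ ≤ bitSize N := mul_le_of_le_one_right (by positivity) (by linarith [Real.log_two_lt_d9])

theorem slowdown_bitSize_le (f : ℕ) {n N : ℕ} (hn : 2 ≤ n) (h : n ≤ N) :
    (slowdown f (bitSize N) : ℝ) ≤ 1 + f / Real.log n := by
  have hlog : 0 < Real.log n := Real.log_pos (by exact_mod_cast hn)
  calc (slowdown f (bitSize N) : ℝ) = 1 + ((f / bitSize N : ℕ) : ℝ) := by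
        rw [slowdown, Nat.cast_add_one, add_comm]
    _ ≤ 1 + f / bitSize N := by gcongr; exact Nat.cast_div_le
    _ ≤ 1 + f / Real.log n := by gcongr; exact log_le_bitSize h

/-- Both bounds on the number `R` of rounds, with the implied constant `C`. -/
structure WithinBounds (γ : ℝ) (n f D : ℕ) (ε : ℝ) (C R : ℕ) : Prop where
  le_mwhvcRounds : (R : ℝ≥0∞) ≤
    ENNReal.ofReal (C * (1 + f / Real.log n)) * (mwhvcRounds γ f D ε : ℝ≥0∞)
  le_closedBound : 3 ≤ D → (R : ℝ) ≤ C * (1 + f / Real.log n) * closedBound γ f D ε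

section Bounds

variable {γ ε : ℝ} {n f D C R : ℕ}

theorem one_le_one_add_div_log (n f : ℕ) : (1 : ℝ) ≤ 1 + f / Real.log n :=
  le_add_of_nonneg_right (div_nonneg f.cast_nonneg (Real.log_natCast_nonneg n))

theorem withinBounds_of_le {a c : ℝ} {T : ℕ} (ha : 0 ≤ a) (hc : 1 ≤ c) (hC : a * c ≤ C)
    (hR : (R : ℝ) ≤ a * (1 + f / Real.log n) * T) (hT : (T : ℕ∞) ≤ mwhvcRounds γ f D ε)
    (hTc : 3 ≤ D → (T : ℝ) ≤ c * closedBound γ f D ε) : WithinBounds γ n f D ε C R := by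
  have hF := one_le_one_add_div_log n f
  set F := 1 + f / Real.log n
  have haC : a ≤ C := (le_mul_of_one_le_right ha hc).trans hC
  refine ⟨?_, fun hD => ?_⟩
  · calc (R : ℝ≥0∞) = ENNReal.ofReal R := (ENNReal.ofReal_natCast R).symm
      _ ≤ ENNReal.ofReal (C * F * T) := ENNReal.ofReal_le_ofReal (hR.trans (by gcongr))
      _ = ENNReal.ofReal (C * F) * ((T : ℕ∞) : ℝ≥0∞) := by
        rw [ENNReal.ofReal_mul (by positivity), ENNReal.ofReal_natCast, ENat.toENNReal_coe]
      _ ≤ ENNReal.ofReal (C * F) * (mwhvcRounds γ f D ε : ℝ≥0∞) := by gcongr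
  · have hTc := hTc hD
    have hbound : 0 ≤ closedBound γ f D ε :=
      nonneg_of_mul_nonneg_right (T.cast_nonneg.trans hTc) (one_pos.trans_le hc)
    calc (R : ℝ) ≤ a * F * T := hR
      _ ≤ a * F * (c * closedBound γ f D ε) := by gcongr
      _ = a * c * F * closedBound γ f D ε := by ring
      _ ≤ C * F * closedBound γ f D ε := by gcongr

theorem withinBounds_of_le_eight (hε : 0 < ε) (hε1 : ε ≤ 1) (hC : 8 ≤ C) (hR : R ≤ 8) :
    WithinBounds γ n f D ε C R := by
  refine withinBounds_of_le (a := 8) (c := 1) (T := 1) (by norm_num) le_rfl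
    (by exact_mod_cast hC) ?_ (le_trans (by norm_num) (two_le_mwhvcRounds γ f D ε)) fun hD => ?_
  · have : (R : ℝ) ≤ 8 := by exact_mod_cast hR
    linarith [one_le_one_add_div_log n f, Nat.cast_one (R := ℝ)]
  · simpa using one_le_closedBound γ f hD hε hε1

theorem withinBounds_of_mwhvcRounds_eq {N T : ℕ} (hf : 2 ≤ f) (hD : 2 ^ f ≤ D) (hε : 0 < ε)
    (hε1 : ε ≤ 1) (hγ : 0 < γ) (hC : 14 * (86 + 16 / γ) ≤ C) (hn : 2 ≤ n) (hN : n ≤ N)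
    (hT : mwhvcRounds γ f D ε = T)
    (hTc : (T : ℝ) ≤ (86 + 16 / γ) * closedBound γ f D ε) :
    WithinBounds γ n f D ε C (slowdown f (bitSize N) * (4 * (1 + f) + 6 * ((T - 2) / 4))) := by
  have hfT := rank_le_mwhvcRounds hf hD hε hε1 hT
  have hT2 : 2 ≤ T := by exact_mod_cast hT ▸ two_le_mwhvcRounds γ f D ε
  have hc : 1 ≤ 86 + 16 / γ := by linarith [show 0 < 16 / γ by positivity]
  refine withinBounds_of_le (by norm_num) hc hC ?_ hT.ge fun _ => hTc
  calc ((slowdown f (bitSize N) * (4 * (1 + f) + 6 * ((T - 2) / 4)) : ℕ) : ℝ)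
      ≤ ((slowdown f (bitSize N) * (14 * T) : ℕ) : ℝ) :=
        Nat.cast_le.2 (Nat.mul_le_mul_left _ (by lia))
    _ = 14 * slowdown f (bitSize N) * T := by push_cast; ring
    _ ≤ 14 * (1 + f / Real.log n) * T := by
        gcongr
        exact slowdown_bitSize_le f hn hN

end Bounds

section Existence

variable {dec : List Bool → ℝ} {κ m n f Δ C : ℕ} {γ ε : ℝ}

theorem rowSupport_le (A : Matrix (Fin m) (Fin n) ℝ) : rowSupport A ≤ n :=
  Finset.sup_le fun _ _ => (Finset.card_filter_le _ _).trans_eq (Finset.card_fin n)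

theorem exists_ne_zero_of_rowSupport_pos {A : Matrix (Fin m) (Fin n) ℝ} (h : 0 < rowSupport A) :
    ∃ i j, A i j ≠ 0 := by
  by_contra! hzero
  simp [rowSupport, hzero] at h

theorem exists_solves_withinBounds_of_le_one (hf : f ≤ 1) (hε : 0 < ε) (hε1 : ε ≤ 1)
    (hC : 8 ≤ C) :
    ∃ alg : DistAlgorithm (Fin n ⊕ Fin m) (LocalInput m) ℝ,
      ∀ P : Program m n, P.IsInstance dec (κ * bitSize (n + m)) f Δ →
        ∃ R, alg.Solves P ((6 * κ + 2) * bitSize (n + m)) R (f + ε) ∧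
          WithinBounds γ n f (2 ^ f * Δ) ε C R := by
  have hs := bitSize_pos (n + m)
  obtain ⟨alg, halg⟩ := exists_solves_of_rowSupport_le_one (m := m) (dec := dec) (κ := κ) (Δ := Δ)
    hs ((Nat.le_add_right n m).trans (lt_two_pow_bitSize _).le) hf
    (le_add_of_nonneg_right (a := (f : ℝ)) hε.le)
  have hslow : slowdown f (bitSize (n + m)) ≤ 2 :=
    Nat.succ_le_succ ((Nat.div_le_self _ _).trans hf)
  have hR : slowdown f (bitSize (n + m)) * (2 * (1 + f)) ≤ 2 * (2 * (1 + 1)) := by gcongr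
  exact ⟨alg, fun P hP => ⟨_, halg P hP, withinBounds_of_le_eight hε hε1 hC hR⟩⟩

theorem exists_solves_withinBounds_of_two_le (hf : 2 ≤ f) (hε : 0 < ε) (hε1 : ε ≤ 1)
    (hγ : 0 < γ) (hΔ : 0 < Δ) (hn : 2 ≤ n) (hC : 14 * (86 + 16 / γ) ≤ C) :
    ∃ alg : DistAlgorithm (Fin n ⊕ Fin m) (LocalInput m) ℝ,
      ∀ P : Program m n, P.IsInstance dec (κ * bitSize (n + m)) f Δ →
        ∃ R, alg.Solves P ((6 * κ + 2) * bitSize (n + m)) R (f + ε) ∧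
          WithinBounds γ n f (2 ^ f * Δ) ε C R := by
  have hN := lt_two_pow_bitSize (n + m)
  have hD : 2 ^ f ≤ 2 ^ f * Δ := Nat.le_mul_of_pos_right _ hΔ
  have hD3 : 3 ≤ 2 ^ f * Δ :=
    (by norm_num : 3 ≤ 2 ^ 2).trans ((Nat.pow_le_pow_right two_pos hf).trans hD)
  obtain ⟨T, hT, hTc⟩ := exists_mwhvcRounds_eq hγ hf hD3 hε hε1
  obtain ⟨alg, halg⟩ := exists_solves_of_iterations (m := m) (dec := dec) (κ := κ) (Δ := Δ)
    (α := multiplier γ f (2 ^ f * Δ) ε) (N := (T - 2) / 4) (bitSize_pos (n + m))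
    ((Nat.le_add_right n m).trans hN.le) ((Nat.le_add_left m n).trans_lt hN)
    (two_pos.trans_le hf) hε (one_le_two.trans (two_le_multiplier _ _ _ _)) fun P hP =>
      uncovered_eq_empty_of_mwhvcRounds_le hP.rankLE hP.degreeLE hP.positiveWeight_pos hT.le
  exact ⟨alg, fun P hP => ⟨_, halg P hP,
    withinBounds_of_mwhvcRounds_eq hf hD hε hε1 hγ hC hn (Nat.le_add_right n m) hT hTc⟩⟩

theorem exists_solves_withinBounds (κ m n f Δ : ℕ) (dec : List Bool → ℝ) (hε : 0 < ε)
    (hε1 : ε ≤ 1) (hγ : 0 < γ) (hC : 14 * (86 + 16 / γ) ≤ C) :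
    ∃ alg : DistAlgorithm (Fin n ⊕ Fin m) (LocalInput m) ℝ,
      ∀ P : Program m n, P.IsInstance dec (κ * bitSize (n + m)) f Δ →
        ∃ R, alg.Solves P ((6 * κ + 2) * bitSize (n + m)) R (f + ε) ∧
          WithinBounds γ n f (2 ^ f * Δ) ε C R := by
  rcases Nat.lt_or_ge f 2 with hf | hf
  · have hC8 : 8 ≤ C := by
      have : (8 : ℝ) ≤ C := by linarith [show 0 < 16 / γ by positivity]
      exact_mod_cast this
    exact exists_solves_withinBounds_of_le_one (Nat.le_of_lt_succ hf) hε hε1 hC8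
  by_cases hinst : ∃ P : Program m n, P.IsInstance dec (κ * bitSize (n + m)) f Δ
  · obtain ⟨P, hP⟩ := hinst
    have hrow : rowSupport P.matrix = f := hP.rowSupport_eq
    obtain ⟨i, j, hij⟩ := exists_ne_zero_of_rowSupport_pos (hrow ▸ two_pos.trans_le hf)
    exact exists_solves_withinBounds_of_two_le hf hε hε1 hγ
      (hP.colSupport_eq ▸ P.one_le_colSupport hij) (hf.trans (hrow ▸ rowSupport_le P.matrix)) hC
  · exact ⟨⟨Unit, fun _ _ => (), fun _ _ => [], fun _ _ => (), fun _ => true, fun _ => 0⟩,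
      fun P hP => (hinst ⟨P, hP⟩).elim⟩

end Existence

end

end DistCover

open DistCover in
/-- For all constants `κ` (input length) and `γ` there are constants `B` (message length) and `C`
(running time) such that, for every number format and all values of the globally known parameters
`n, m, f, Δ, ε`, some deterministic distributed algorithm computes an `(f + ε)`-approximate
solution of every feasible zero-one covering program with these parameters, in the stated number of
rounds. -/
theorem mainTheorem8 (κ : ℕ) (γ : ℝ) (hγ : 0 < γ) :
    ∃ B C : ℕ, ∀ (dec : List Bool → ℝ) (n m f Δ : ℕ) (ε : ℝ), 0 < ε → ε ≤ 1 →
      ∃ alg : DistAlgorithm (Fin n ⊕ Fin m) (LocalInput m) ℝ,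
        ∀ (A : Matrix (Fin m) (Fin n) ℝ) (b : Fin m → ℝ) (w : Fin n → ℝ),
          IsCovering A b w → rowSupport A = f → colSupport A = Δ →
          InputHasCodes dec (κ * bitSize (n + m)) A b w →
          (∃ y, IsZeroOneSolution A b y) →
          alg.MessagesLE (network A) (localInput A b w) (B * bitSize (n + m)) ∧
          ∃ R : ℕ,
            alg.HaltsWithin (network A) (localInput A b w) R ∧
            IsApproxSolution A b w (f + ε) (fun j =>
              alg.output (alg.config (network A) (localInput A b w) R (Sum.inl j))) ∧
            (R : ENNReal) ≤ ENNReal.ofReal (C * (1 + f / Real.log n)) *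
              (mwhvcRounds γ f (2 ^ f * Δ) ε : ENNReal) ∧
            (3 ≤ 2 ^ f * Δ →
              (R : ℝ) ≤ C * (1 + f / Real.log n) * closedBound γ f (2 ^ f * Δ) ε) := by
  obtain ⟨C, hC⟩ := exists_nat_ge (14 * (86 + 16 / γ))
  refine ⟨6 * κ + 2, C, fun dec n m f Δ ε hε hε1 => ?_⟩
  obtain ⟨alg, halg⟩ := exists_solves_withinBounds κ m n f Δ dec hε hε1 hγ hC
  refine ⟨alg, fun A b w hcovering hf hΔ hcodes hfeasible => ?_⟩
  obtain ⟨R, hsolves, hbounds⟩ := halg ⟨A, b, w⟩ ⟨hcovering, hf, hΔ, hcodes, hfeasible⟩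
  exact ⟨hsolves.messagesLE, R, hsolves.haltsWithin, hsolves.isApproxSolution,
    hbounds.le_mwhvcRounds, hbounds.le_closedBound⟩
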